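/- **Theorem 1.1.** Write $\log(x)$ for the natural logarithm of $\max\{x,e\}$, $x\ge 0$. A real function is *slowly varying* if it is positive and measurable on $[A,\infty)$ for some $A>0$ and $R(\lambda x)/R(x)\to 1$ as $x\to\infty$ for every $\lambda>0$. Let $1\le p<2$, and let $\{X_n,n\ge1\}$ be a sequence of real random variables on a probability space for which there is a constant $C$ such that $$\operatorname{Var}\Bigl(\sum_{i=k+1}^{k+\ell}f_i(X_i)\Bigr)\le C\sum_{i=k+1}^{k+\ell}\operatorname{Var}(f_i(X_i))$$ for all $k\ge0$, $\ell\ge1$ and all nondecreasing functions $f_i:\mathbb R\to\mathbb R$, $i\ge1$, such that $f_i(X_i)$ is square integrable for $k+1\le i\le k+\ell$. Let $L$ be a slowly varying real function on $[0,\infty)$ which is continuous on $[0,\infty)$, differentiable on $[A,\infty)$ for some $A>0$, and satisfies $\lim_{x\to\infty}xL'(x)/L(x)=0$. When $p=1$, assume further that $L(x)\ge1$ for all $x\ge 0$ and that $L$ is nondecreasing on $[0,\infty)$. Let $\tilde L$ be a de Bruijn conjugate of $L$, that is, a slowly varying function with $$\lim_{x\to\infty}L(x)\tilde L(xL(x))=1\quad\text{and}\quad\lim_{x\to\infty}\tilde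 L(x)L(x\tilde L(x))=1 .$$ If $$\sup_{n\ge1}\mathbb E\bigl(|X_n|^pL^p(|X_n|)\log(|X_n|)\log^2(\log(|X_n|))\bigr)<\infty$$ (on the bounded set of $x\ge0$, if any, where $L(x)<0$, $L^p(x)$ may be read as $0$), then every $X_n$ is integrable, and for all $\alpha\ge1/p$ and all $\varepsilon>0$, $$\sum_{n=1}^\infty n^{\alpha p-2}\,\mathbb P\Bigl(\max_{1\le j\le n}\Bigl|\sum_{i=1}^j(X_i-\mathbb E(X_i))\Bigr|>\varepsilon n^{\alpha}\tilde L(n^{\alpha})\Bigr)<\infty .$$ -/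

import Mathlib

open MeasureTheory ProbabilityTheory Filter Topology

noncomputable section

/-- The convention `log x = ln (max {x, e})`. -/
def truncLog (x : ℝ) : ℝ := Real.log (max x (Real.exp 1))

/-- `R` is regularly varying (at infinity) with index `ρ`: it is positive and measurable on some
half-line `[A, ∞)`, `A > 0`, and `R (c x) / R x → c ^ ρ` as `x → ∞`, for every `c > 0`. -/
structure IsRegularlyVarying (ρ : ℝ) (R : ℝ → ℝ) : Prop where
  pos_measurable : ∃ A : ℝ, 0 < A ∧ (∀ x, A ≤ x → 0 < R x) ∧
    Measurable (fun x : Set.Ici A => R x)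
  tendsto_ratio : ∀ c : ℝ, 0 < c → Tendsto (fun x => R (c * x) / R x) atTop (𝓝 (c ^ ρ))

/-- Slowly varying at infinity: regularly varying with index `0`. -/
def IsSlowlyVarying (L : ℝ → ℝ) : Prop := IsRegularlyVarying 0 L

/-- `Lt` is a de Bruijn conjugate of the slowly varying function `L` (it is determined by `L` up to
asymptotic equivalence). -/
structure IsDeBruijnConjugate (L Lt : ℝ → ℝ) : Prop where
  slowlyVarying : IsSlowlyVarying Lt
  tendsto_left : Tendsto (fun x => L x * Lt (x * L x)) atTop (𝓝 1)
  tendsto_right : Tendsto (fun x => Lt x * L (x * Lt x)) atTop (𝓝 1)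

/-- The regularity which is always assumed of `L`: continuous on `[0, ∞)`, differentiable on some
half-line `[A, ∞)`, and `x L'(x) / L(x) → 0`. -/
structure IsNormalized (L : ℝ → ℝ) : Prop where
  continuousOn : ContinuousOn L (Set.Ici 0)
  differentiable : ∃ A : ℝ, 0 < A ∧ ∀ x, A ≤ x → DifferentiableAt ℝ L x
  tendsto_log_deriv : Tendsto (fun x => x * deriv L x / L x) atTop (𝓝 0)

variable {Ω : Type*} [MeasurableSpace Ω]

/-- The variance inequality with constant `C` for the sequence `X 1, X 2, …`
(`X 0` plays no role). The variances exist when the `f i (X i)` are square integrable. -/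
def VarianceInequality (μ : Measure Ω) (X : ℕ → Ω → ℝ) (C : ℝ) : Prop :=
  ∀ (k l : ℕ), 1 ≤ l → ∀ f : ℕ → ℝ → ℝ, (∀ i, Monotone (f i)) →
    (∀ i ∈ Finset.Icc (k + 1) (k + l), MemLp (fun ω => f i (X i ω)) 2 μ) →
    variance (fun ω => ∑ i ∈ Finset.Icc (k + 1) (k + l), f i (X i ω)) μ
      ≤ C * ∑ i ∈ Finset.Icc (k + 1) (k + l), variance (fun ω => f i (X i ω)) μ

/-- `max_{1 ≤ j ≤ n} |∑_{i=1}^j (X_i - E X_i)|` for `n ≥ 1`. -/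
def maxAbsCenteredSum (μ : Measure Ω) (X : ℕ → Ω → ℝ) (n : ℕ+) (ω : Ω) : ℝ :=
  (Finset.Icc 1 (n : ℕ)).sup' (Finset.nonempty_Icc.mpr n.pos)
    (fun j => |∑ i ∈ Finset.Icc 1 j, (X i ω - ∫ ω', X i ω' ∂μ)|)

end

/-! Put `Q = 2 ^ α`, `q = 2 ^ (α * p) = Q ^ p`, and let `γ` be the inverse near infinity of `x ↦ x *
L x`. The normalization `y * Lt y` at `y = n ^ α` is eventually at least `γ y / 2`, so it suffices
to work with the levels `c m = γ (Q ^ (m + m₀))`. Slow variation gives `r * c m ≤ c (m + 1) ≤ q * c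
m` for some `r > 1` with `q < r ^ 2`; this is where `p < 2` enters. By Markov's inequality the
moment condition gives tails `P(|X i| > c m) ≤ a m / q ^ m` with `a m` a multiple of `1 / logWeight
(r ^ m)`, of order `1 / (m * log m ^ 2)`. After that only the summability of `a` and the geometric
growth of `c` are used (`summable_measureReal_dyadic_max`).

No maximal inequality is available, only variances of sums over blocks of monotone transforms. The
maximum over `j ≤ 2 ^ n` is handled by chaining along the binary digits of `j`, with the truncation
level tied to the scale: blocks of length `2 ^ m` carry variables truncated at `c m`. Changing scale
costs an increment of truncations summed over an incomplete block. Its absolute value is a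
difference of two nondecreasing functions, so it is dominated termwise and the sum is enlarged to
the full block, where the variance inequality applies.

At scale `m` there are about `2 ^ (n - m)` blocks, and the allowed deviation is `η * c n * s ^ (n -
m)` with `s < 1`, so the deviations add up to a multiple of `c n`. If also `q < (r * s) ^ 2`,
Chebyshev's bounds, weighted by `(q / 2) ^ n`, form the convolution of a summable sequence with a
geometric one. The errors in the expectations are `o(c n)`. -/

/-! ### Truncation and its increments. -/

/-- Truncation of `x` at the levels `-c` and `c`. -/
def clampAt (c x : ℝ) : ℝ := max (-c) (min x c)

lemma clampAt_monotone (c : ℝ) : Monotone (clampAt c) := fun _ _ h =>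
  max_le_max le_rfl (min_le_min h le_rfl)

lemma clampAt_continuous (c : ℝ) : Continuous (clampAt c) := by
  unfold clampAt; fun_prop

lemma abs_clampAt_le {c : ℝ} (hc : 0 ≤ c) (x : ℝ) : |clampAt c x| ≤ min |x| c := by
  unfold clampAt
  rcases le_total x c with h1 | h1 <;> rcases le_total (-c) x with h2 | h2
  · rw [min_eq_left h1, max_eq_right h2]; exact le_min le_rfl (abs_le.2 ⟨h2, h1⟩)
  · rw [min_eq_left h1, max_eq_left h2, abs_neg, abs_of_nonneg hc]
    exact le_min (by rw [abs_of_nonpos (by linarith)]; linarith) le_rfl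
  · rw [min_eq_right h1, max_eq_right (by linarith), abs_of_nonneg hc]
    exact le_min (h1.trans (le_abs_self x)) le_rfl
  · rw [min_eq_right h1, max_eq_right (by linarith), abs_of_nonneg hc]
    exact le_min (h1.trans (le_abs_self x)) le_rfl

lemma clampAt_eq_self {c x : ℝ} (h : |x| ≤ c) : clampAt c x = x := by
  rw [abs_le] at h
  rw [clampAt, min_eq_left h.2, max_eq_right h.1]

/-- The increment vanishes on `[-c, c]`, has slope one between the levels and is constant beyond
`d`. Its monotonicity makes increments, and their positive and negative parts, admissible in the
variance inequality. -/
lemma clampAt_sub_monotone {c d : ℝ} (hc : 0 ≤ c) (hcd : c ≤ d) :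
    Monotone (fun x => clampAt d x - clampAt c x) := by
  intro x y h
  simp only [clampAt, max_def, min_def]
  split_ifs <;> linarith

lemma abs_clampAt_sub_le {c d : ℝ} (hc : 0 ≤ c) (hcd : c ≤ d) (x : ℝ) :
    |clampAt d x - clampAt c x| ≤ min |x| d := by
  rcases le_total 0 x with hx | hx
  · rw [abs_of_nonneg hx, abs_of_nonneg]
    · simp only [clampAt, max_def, min_def]
      split_ifs <;> linarith
    · simp only [clampAt, max_def, min_def]
      split_ifs <;> linarith
  · rw [abs_of_nonpos hx, abs_of_nonpos]
    · simp only [clampAt, max_def, min_def]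
      split_ifs <;> linarith
    · simp only [clampAt, max_def, min_def]
      split_ifs <;> linarith

lemma abs_self_sub_clampAt_le {c : ℝ} (hc : 0 ≤ c) (x : ℝ) : |x - clampAt c x| ≤ |x| := by
  have h := abs_clampAt_sub_le hc (le_max_left c |x|) x
  rw [clampAt_eq_self (le_max_right c |x|)] at h
  exact h.trans (min_le_left _ _)

/-! ### Deterministic chaining along binary digits. -/

/-- Dyadic chaining: a partial sum of `Z n` over the last incomplete block of length `2 ^ n` is
controlled by shorter block sums and by the increments `Z (m + 1) - Z m`. -/
lemma abs_sum_Ioc_le_chaining (Z : ℕ → ℕ → ℝ) (A B : ℕ → ℝ) (n j : ℕ)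
    (hA : ∀ m < n, |∑ i ∈ Finset.Ioc (j / 2 ^ (m + 1) * 2 ^ (m + 1)) (j / 2 ^ m * 2 ^ m), Z m i|
      ≤ A m)
    (hB : ∀ m < n, |∑ i ∈ Finset.Ioc (j / 2 ^ (m + 1) * 2 ^ (m + 1)) j, (Z (m + 1) i - Z m i)|
      ≤ B m) :
    |∑ i ∈ Finset.Ioc (j / 2 ^ n * 2 ^ n) j, Z n i| ≤ ∑ m ∈ Finset.range n, (A m + B m) := by
  induction n with
  | zero => simp
  | succ n ih =>
    have h1 : j / 2 ^ (n + 1) * 2 ^ (n + 1) ≤ j / 2 ^ n * 2 ^ n := by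
      rw [pow_succ, ← Nat.div_div_eq_div_mul, mul_comm (2 ^ n) 2, ← mul_assoc]
      exact Nat.mul_le_mul_right _ (Nat.div_mul_le_self _ _)
    have h2 : j / 2 ^ n * 2 ^ n ≤ j := Nat.div_mul_le_self _ _
    -- Split off the digit of `j` at position `n`: the shorter remainder, one block of length `0` or
    -- `2 ^ n`, and the price of passing from `Z n` to `Z (n + 1)` on the whole remainder.
    have key : ∑ i ∈ Finset.Ioc (j / 2 ^ (n + 1) * 2 ^ (n + 1)) j, Z (n + 1) i
        = ∑ i ∈ Finset.Ioc (j / 2 ^ n * 2 ^ n) j, Z n i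
          + (∑ i ∈ Finset.Ioc (j / 2 ^ (n + 1) * 2 ^ (n + 1)) (j / 2 ^ n * 2 ^ n), Z n i
          + ∑ i ∈ Finset.Ioc (j / 2 ^ (n + 1) * 2 ^ (n + 1)) j, (Z (n + 1) i - Z n i)) := by
      rw [Finset.sum_sub_distrib, ← Finset.sum_Ioc_consecutive (Z n) h1 h2]
      ring
    rw [key, Finset.sum_range_succ]
    refine (abs_add_le _ _).trans (add_le_add (ih (fun m hm => hA m (by omega))
      (fun m hm => hB m (by omega))) ((abs_add_le _ _).trans
        (add_le_add (hA n (by omega)) (hB n (by omega)))))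

/-! ### Moments of truncated variables from tail bounds, and Chebyshev's inequality on blocks. -/

section Moments

variable {Ω : Type*} [MeasurableSpace Ω] {μ : Measure Ω} [IsProbabilityMeasure μ]

lemma integrable_of_abs_le_const {Y : Ω → ℝ} (hY : Measurable Y) {c : ℝ} (h : ∀ ω, |Y ω| ≤ c) :
    Integrable Y μ :=
  Integrable.of_bound hY.aestronglyMeasurable c (ae_of_all _ h)

/-- A discrete layer-cake bound: each level `c k` that `|y|` exceeds contributes the square of the
next level. Integration turns it into a second moment bound by tails. -/
lemma sq_min_le_sum_indicator {c : ℕ → ℝ} (hc : ∀ m, 0 < c m) (y : ℝ) (m : ℕ) :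
    (min |y| (c m)) ^ 2 ≤ c 0 ^ 2 +
      ∑ k ∈ Finset.range m, c (k + 1) ^ 2 * (Set.Ioi (c k)).indicator (fun _ => (1 : ℝ)) |y| := by
  induction m with
  | zero =>
    simp only [Finset.range_zero, Finset.sum_empty, add_zero]
    exact pow_le_pow_left₀ (le_min (abs_nonneg _) (hc 0).le) (min_le_right _ _) 2
  | succ m ih =>
    rw [Finset.sum_range_succ]
    by_cases h : c m < |y|
    · rw [Set.indicator_of_mem (by exact h)]
      have h1 : (min |y| (c (m + 1))) ^ 2 ≤ c (m + 1) ^ 2 :=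
        pow_le_pow_left₀ (le_min (abs_nonneg _) (hc _).le) (min_le_right _ _) 2
      have h2 : 0 ≤ c 0 ^ 2 + ∑ k ∈ Finset.range m,
          c (k + 1) ^ 2 * (Set.Ioi (c k)).indicator (fun _ => (1 : ℝ)) |y| :=
        (sq_nonneg _).trans ih
      linarith
    · rw [Set.indicator_of_notMem (by exact h)]
      push Not at h
      rw [min_eq_left h] at ih
      have h1 : (min |y| (c (m + 1))) ^ 2 ≤ |y| ^ 2 :=
        pow_le_pow_left₀ (le_min (abs_nonneg _) (hc _).le) (min_le_left _ _) 2
      linarith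

lemma integral_sq_le_of_tail {Y : Ω → ℝ} (hY : Measurable Y) {c t : ℕ → ℝ} (hc : ∀ m, 0 < c m)
    (ht : ∀ m, μ.real {ω | c m < |Y ω|} ≤ t m) {φ : ℝ → ℝ} {m : ℕ}
    (hφ : ∀ x, |φ x| ≤ min |x| (c m)) :
    ∫ ω, φ (Y ω) ^ 2 ∂μ ≤ c 0 ^ 2 + ∑ k ∈ Finset.range m, c (k + 1) ^ 2 * t k := by
  have hset : ∀ k, MeasurableSet {ω | c k < |Y ω|} := fun k =>
    measurableSet_lt measurable_const hY.abs
  have hind : ∀ k, (fun ω => (Set.Ioi (c k)).indicator (fun _ => (1 : ℝ)) |Y ω|)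
      = {ω | c k < |Y ω|}.indicator (fun _ => (1 : ℝ)) := by
    intro k; ext ω; simp [Set.indicator]
  have hint : ∀ k, Integrable (fun ω => c (k + 1) ^ 2 *
      (Set.Ioi (c k)).indicator (fun _ => (1 : ℝ)) |Y ω|) μ := by
    intro k
    refine Integrable.const_mul ?_ _
    rw [hind]
    exact (integrable_const _).indicator (hset k)
  calc ∫ ω, φ (Y ω) ^ 2 ∂μ
      ≤ ∫ ω, (c 0 ^ 2 + ∑ k ∈ Finset.range m,
          c (k + 1) ^ 2 * (Set.Ioi (c k)).indicator (fun _ => (1 : ℝ)) |Y ω|) ∂μ := by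
        refine integral_mono_of_nonneg (ae_of_all _ fun ω => sq_nonneg _)
          ((integrable_const _).add (integrable_finsetSum _ fun k _ => hint k))
          (ae_of_all _ fun ω => ?_)
        refine le_trans ?_ (sq_min_le_sum_indicator hc (Y ω) m)
        simp only
        rw [← sq_abs]
        exact pow_le_pow_left₀ (abs_nonneg _) (hφ _) 2
    _ = c 0 ^ 2 + ∑ k ∈ Finset.range m, c (k + 1) ^ 2 * μ.real {ω | c k < |Y ω|} := by
        rw [integral_add (integrable_const _) (integrable_finsetSum _ fun k _ => hint k),
          integral_finsetSum _ fun k _ => hint k]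
        congr 1
        · simp
        · refine Finset.sum_congr rfl fun k _ => ?_
          rw [integral_const_mul, hind, integral_indicator_const _ (hset k)]
          simp
    _ ≤ _ := by
        gcongr with k _
        exact ht k

lemma integral_abs_clampAt_sub_le_of_tail {Y : Ω → ℝ} (hY : Measurable Y) {c d t : ℝ}
    (hc : 0 ≤ c) (hcd : c ≤ d) (ht : μ.real {ω | c < |Y ω|} ≤ t) :
    ∫ ω, |clampAt d (Y ω) - clampAt c (Y ω)| ∂μ ≤ d * t := by
  have hset : MeasurableSet {ω | c < |Y ω|} := measurableSet_lt measurable_const hY.abs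
  calc ∫ ω, |clampAt d (Y ω) - clampAt c (Y ω)| ∂μ
      ≤ ∫ ω, {ω | c < |Y ω|}.indicator (fun _ => d) ω ∂μ := by
        refine integral_mono_of_nonneg (ae_of_all _ fun ω => abs_nonneg _)
          ((integrable_const _).indicator hset) (ae_of_all _ fun ω => ?_)
        simp only
        by_cases h : c < |Y ω|
        · rw [Set.indicator_of_mem (by exact h)]
          exact (abs_clampAt_sub_le hc hcd _).trans (min_le_right _ _)
        · rw [Set.indicator_of_notMem (by exact h)]
          push Not at h
          rw [clampAt_eq_self h, clampAt_eq_self (h.trans hcd)]; simp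
    _ = μ.real {ω | c < |Y ω|} * d := by
        rw [integral_indicator_const _ hset]; simp
    _ ≤ d * t := by
        rw [mul_comm]; exact mul_le_mul_of_nonneg_left ht (hc.trans hcd)

lemma lintegral_sub_clampAt_le_of_tail {Y : Ω → ℝ} (hY : Measurable Y) {c t : ℕ → ℝ}
    (hc : ∀ m, 0 < c m) (hctop : Tendsto c atTop atTop)
    (ht : ∀ m, μ.real {ω | c m < |Y ω|} ≤ t m)
    (hs : Summable fun k => c (k + 1) * t k) (n : ℕ) :
    ∫⁻ ω, ENNReal.ofReal |Y ω - clampAt (c n) (Y ω)| ∂μ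
      ≤ ENNReal.ofReal (∑' k, c (k + n + 1) * t (k + n)) := by
  have hset : ∀ k, MeasurableSet {ω | c k < |Y ω|} := fun k =>
    measurableSet_lt measurable_const hY.abs
  have ht0 : ∀ k, 0 ≤ t k := fun k => measureReal_nonneg.trans (ht k)
  have hpt : ∀ ω, ENNReal.ofReal |Y ω - clampAt (c n) (Y ω)| ≤
      ∑' k, {ω | c (k + n) < |Y ω|}.indicator (fun _ => ENNReal.ofReal (c (k + n + 1))) ω := by
    intro ω
    by_cases h : |Y ω| ≤ c n
    · rw [clampAt_eq_self h]; simp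
    -- Beyond `c n`, locate `|Y ω|` between two consecutive levels; that single term of the series
    -- already dominates it.
    · have hex : ∃ k, |Y ω| ≤ c (k + n) :=
        ((tendsto_add_atTop_iff_nat n).2 hctop |>.eventually_ge_atTop |Y ω|).exists
      classical
      obtain ⟨k, hk⟩ : ∃ k, Nat.find hex = k + 1 := by
        refine Nat.exists_eq_succ_of_ne_zero fun h0 => h ?_
        have := Nat.find_spec hex
        rwa [h0, zero_add] at this
      have h1 : |Y ω| ≤ c (k + n + 1) := by
        have := Nat.find_spec hex
        rwa [hk, add_right_comm] at this
      have h2 : c (k + n) < |Y ω| := not_le.1 (Nat.find_min hex (m := k) (by omega))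
      refine le_trans ?_ (ENNReal.le_tsum k)
      rw [Set.indicator_of_mem (by exact h2)]
      exact ENNReal.ofReal_le_ofReal ((abs_self_sub_clampAt_le (hc n).le _).trans h1)
  calc ∫⁻ ω, ENNReal.ofReal |Y ω - clampAt (c n) (Y ω)| ∂μ
      ≤ ∫⁻ ω, ∑' k, {ω | c (k + n) < |Y ω|}.indicator
          (fun _ => ENNReal.ofReal (c (k + n + 1))) ω ∂μ := lintegral_mono hpt
    _ = ∑' k, ENNReal.ofReal (c (k + n + 1)) * μ {ω | c (k + n) < |Y ω|} := by
        rw [lintegral_tsum fun k => (measurable_const.indicator (hset _)).aemeasurable]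
        exact tsum_congr fun k => lintegral_indicator_const (hset _) _
    _ ≤ ∑' k, ENNReal.ofReal (c (k + n + 1) * t (k + n)) := by
        refine ENNReal.tsum_le_tsum fun k => ?_
        rw [ENNReal.ofReal_mul (hc _).le]
        gcongr
        rw [← ofReal_measureReal]
        exact ENNReal.ofReal_le_ofReal (ht _)
    _ = ENNReal.ofReal (∑' k, c (k + n + 1) * t (k + n)) := by
        rw [ENNReal.ofReal_tsum_of_nonneg (fun k => mul_nonneg (hc _).le (ht0 _))]
        exact (summable_nat_add_iff (f := fun k => c (k + 1) * t k) n).2 hs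

lemma integrable_of_tail {Y : Ω → ℝ} (hY : Measurable Y) {c t : ℕ → ℝ}
    (hc : ∀ m, 0 < c m) (hctop : Tendsto c atTop atTop)
    (ht : ∀ m, μ.real {ω | c m < |Y ω|} ≤ t m)
    (hs : Summable fun k => c (k + 1) * t k) : Integrable Y μ := by
  have h0 : Integrable (fun ω => clampAt (c 0) (Y ω)) μ :=
    integrable_of_abs_le_const ((clampAt_continuous _).measurable.comp hY)
      fun ω => (abs_clampAt_le (hc 0).le _).trans (min_le_right _ _)
  have h1 : Integrable (fun ω => Y ω - clampAt (c 0) (Y ω)) μ := by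
    refine ⟨(hY.sub ((clampAt_continuous _).measurable.comp hY)).aestronglyMeasurable, ?_⟩
    rw [hasFiniteIntegral_iff_norm]
    exact (lintegral_sub_clampAt_le_of_tail hY hc hctop ht hs 0).trans_lt ENNReal.ofReal_lt_top
  exact (h1.add h0).congr (ae_of_all _ fun ω => by simp)

lemma integral_abs_sub_clampAt_le_of_tail {Y : Ω → ℝ} (hY : Measurable Y) {c t : ℕ → ℝ}
    (hc : ∀ m, 0 < c m) (hctop : Tendsto c atTop atTop)
    (ht : ∀ m, μ.real {ω | c m < |Y ω|} ≤ t m)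
    (hs : Summable fun k => c (k + 1) * t k) (n : ℕ) :
    ∫ ω, |Y ω - clampAt (c n) (Y ω)| ∂μ ≤ ∑' k, c (k + n + 1) * t (k + n) := by
  have ht0 : ∀ k, 0 ≤ t k := fun k => measureReal_nonneg.trans (ht k)
  rw [integral_eq_lintegral_of_nonneg_ae (ae_of_all _ fun ω => abs_nonneg _)
    (show Measurable fun ω => |Y ω - clampAt (c n) (Y ω)| from
      (hY.sub ((clampAt_continuous _).measurable.comp hY)).abs).aestronglyMeasurable]
  exact ENNReal.toReal_le_of_le_ofReal (tsum_nonneg fun k => mul_nonneg (hc _).le (ht0 _))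
    (lintegral_sub_clampAt_le_of_tail hY hc hctop ht hs n)

/-- Chebyshev's inequality for the sum of a block of monotone transforms. -/
lemma VarianceInequality.measureReal_block_le {X : ℕ → Ω → ℝ} (hX : ∀ n, 1 ≤ n → Measurable (X n))
    {C : ℝ} (hC : 0 ≤ C) (hvar : VarianceInequality μ X C) {c t : ℕ → ℝ} (hc : ∀ m, 0 < c m)
    (ht : ∀ i, 1 ≤ i → ∀ m, μ.real {ω | c m < |X i ω|} ≤ t m) {φ : ℝ → ℝ} {m : ℕ}
    (hmono : Monotone φ) (hφ : ∀ x, |φ x| ≤ min |x| (c m)) (k : ℕ) {l : ℕ} (hl : 1 ≤ l)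
    {lam : ℝ} (hlam : 0 < lam) :
    μ.real {ω | lam ≤ |∑ i ∈ Finset.Ioc k (k + l), (φ (X i ω) - ∫ ω', φ (X i ω') ∂μ)|}
      ≤ C * l * (c 0 ^ 2 + ∑ k ∈ Finset.range m, c (k + 1) ^ 2 * t k) / lam ^ 2 := by
  have hIoc : Finset.Ioc k (k + l) = Finset.Icc (k + 1) (k + l) :=
    (Finset.Icc_add_one_left_eq_Ioc _ _).symm
  have hmeas : ∀ i ∈ Finset.Ioc k (k + l), Measurable (fun ω => φ (X i ω)) := fun i hi =>
    hmono.measurable.comp (hX i (by have := Finset.mem_Ioc.1 hi; omega))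
  have hLp : ∀ i ∈ Finset.Ioc k (k + l), MemLp (fun ω => φ (X i ω)) 2 μ := fun i hi =>
    MemLp.of_bound (hmeas i hi).aestronglyMeasurable (c m)
      (ae_of_all _ fun ω => (hφ _).trans (min_le_right _ _))
  have hsumLp : MemLp (fun ω => ∑ i ∈ Finset.Ioc k (k + l), φ (X i ω)) 2 μ :=
    memLp_finsetSum _ hLp
  have hv : variance (fun ω => ∑ i ∈ Finset.Ioc k (k + l), φ (X i ω)) μ
      ≤ C * (l * (c 0 ^ 2 + ∑ k ∈ Finset.range m, c (k + 1) ^ 2 * t k)) := by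
    have h := hvar k l hl (fun _ => φ) (fun _ => hmono) (by rwa [hIoc] at hLp)
    rw [← hIoc] at h
    refine h.trans (mul_le_mul_of_nonneg_left ?_ hC)
    calc ∑ i ∈ Finset.Ioc k (k + l), variance (fun ω => φ (X i ω)) μ
        ≤ ∑ i ∈ Finset.Ioc k (k + l),
          (c 0 ^ 2 + ∑ k ∈ Finset.range m, c (k + 1) ^ 2 * t k) := by
          refine Finset.sum_le_sum fun i hi => ?_
          have hi1 : 1 ≤ i := by have := Finset.mem_Ioc.1 hi; omega
          exact (variance_le_expectation_sq (hmeas i hi).aestronglyMeasurable).trans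
            (integral_sq_le_of_tail (hX i hi1) hc (ht i hi1) hφ)
      _ = _ := by rw [Finset.sum_const, Nat.card_Ioc, nsmul_eq_mul, Nat.add_sub_cancel_left]
  have hcheb := meas_ge_le_variance_div_sq hsumLp hlam
  have heq : ∀ ω, (∑ i ∈ Finset.Ioc k (k + l), φ (X i ω))
      - ∫ ω', (∑ i ∈ Finset.Ioc k (k + l), φ (X i ω')) ∂μ
      = ∑ i ∈ Finset.Ioc k (k + l), (φ (X i ω) - ∫ ω', φ (X i ω') ∂μ) := by
    intro ω
    rw [integral_finsetSum _ fun i hi => (hLp i hi).integrable (by norm_num),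
      Finset.sum_sub_distrib]
  simp only [heq] at hcheb
  refine (ENNReal.toReal_le_of_le_ofReal (div_nonneg (variance_nonneg _ _) (sq_nonneg _))
    hcheb).trans ?_
  rw [mul_assoc]
  exact div_le_div_of_nonneg_right hv (sq_nonneg _)

end Moments

/-! ### The exceptional event at one dyadic scale. -/

section Dyadic

variable {Ω : Type*} [MeasurableSpace Ω]

/-- The event that the centered sum of `φ (X i)` over `k < i ≤ k + l` is at least `lam` in
absolute value. -/
def blockDeviation (μ : Measure Ω) (X : ℕ → Ω → ℝ) (φ : ℝ → ℝ) (k l : ℕ) (lam : ℝ) : Set Ω :=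
  {ω | lam ≤ |∑ i ∈ Finset.Ioc k (k + l), (φ (X i ω) - ∫ ω', φ (X i ω') ∂μ)|}

lemma le_of_notMem_blockDeviation {μ : Measure Ω} {X : ℕ → Ω → ℝ} {φ : ℝ → ℝ} {k l : ℕ} {lam : ℝ}
    {ω : Ω} (h : ω ∉ blockDeviation μ X φ k l lam) :
    |∑ i ∈ Finset.Ioc k (k + l), (φ (X i ω) - ∫ ω', φ (X i ω') ∂μ)| ≤ lam :=
  (not_le.1 h).le

/-- The positive part of the increment of the truncation between two levels. -/
def posIncrement (c d x : ℝ) : ℝ := max 0 (clampAt d x - clampAt c x)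

/-- The negative part, with its sign, of the increment of the truncation between two levels. -/
def negIncrement (c d x : ℝ) : ℝ := min 0 (clampAt d x - clampAt c x)

/-- The absolute value of an increment is not monotone, but this writes it as a difference of two
nondecreasing functions, to each of which the variance inequality applies. -/
lemma abs_increment_eq (c d x : ℝ) :
    |clampAt d x - clampAt c x| = posIncrement c d x - negIncrement c d x := by
  rw [posIncrement, negIncrement, max_sub_min_eq_abs', zero_sub, abs_neg]

lemma posIncrement_monotone {c d : ℝ} (hc : 0 ≤ c) (hcd : c ≤ d) : Monotone (posIncrement c d) :=
  fun _ _ h => max_le_max le_rfl (clampAt_sub_monotone hc hcd h)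

lemma negIncrement_monotone {c d : ℝ} (hc : 0 ≤ c) (hcd : c ≤ d) : Monotone (negIncrement c d) :=
  fun _ _ h => min_le_min le_rfl (clampAt_sub_monotone hc hcd h)

lemma abs_posIncrement_le {c d : ℝ} (hc : 0 ≤ c) (hcd : c ≤ d) (x : ℝ) :
    |posIncrement c d x| ≤ min |x| d := by
  refine le_trans ?_ (abs_clampAt_sub_le hc hcd x)
  rw [posIncrement, abs_of_nonneg (le_max_left _ _)]
  exact max_le (abs_nonneg _) (le_abs_self _)

lemma abs_negIncrement_le {c d : ℝ} (hc : 0 ≤ c) (hcd : c ≤ d) (x : ℝ) :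
    |negIncrement c d x| ≤ min |x| d := by
  refine le_trans ?_ (abs_clampAt_sub_le hc hcd x)
  rw [negIncrement, abs_of_nonpos (min_le_left _ _), neg_le]
  exact le_min (neg_nonpos.2 (abs_nonneg _)) (neg_abs_le _)

lemma integrable_comp_of_monotone {μ : Measure Ω} [IsProbabilityMeasure μ] {Y : Ω → ℝ}
    (hY : Measurable Y) {φ : ℝ → ℝ} {c : ℝ} (hmono : Monotone φ) (hφ : ∀ x, |φ x| ≤ min |x| c) :
    Integrable (fun ω => φ (Y ω)) μ :=
  integrable_of_abs_le_const (hmono.measurable.comp hY) fun _ => (hφ _).trans (min_le_right _ _)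

/-- The exceptional event of the chaining argument at the dyadic scale `2 ^ n`. -/
def chainingEvent (μ : Measure Ω) (X : ℕ → Ω → ℝ) (c lam : ℕ → ℝ) (n : ℕ) : Set Ω :=
  -- The extra index in the range of `s` is needed for `j = 2 ^ n`; the blocks it names reach beyond
  -- `2 ^ n`, which is harmless because the hypotheses hold for all indices.
  (⋃ m ∈ Finset.range n, ⋃ s ∈ Finset.range (2 ^ (n - (m + 1)) + 1),
    ((blockDeviation μ X (clampAt (c m)) (s * 2 ^ (m + 1)) (2 ^ m) (lam (m + 1)) ∪
      blockDeviation μ X (posIncrement (c m) (c (m + 1))) (s * 2 ^ (m + 1)) (2 ^ (m + 1))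
        (lam (m + 1))) ∪
      blockDeviation μ X (negIncrement (c m) (c (m + 1))) (s * 2 ^ (m + 1)) (2 ^ (m + 1))
        (lam (m + 1)))) ∪
  (blockDeviation μ X (clampAt (c n)) 0 (2 ^ n) (lam n) ∪
    ⋃ i ∈ Finset.Icc 1 (2 ^ n), {ω | c n < |X i ω|})

variable {μ : Measure Ω} [IsProbabilityMeasure μ] {X : ℕ → Ω → ℝ} {c t lam : ℕ → ℝ}

/-- Union bound with Chebyshev on every block. The `7` is `3` events per block, doubled since `2 ^
(n - (m + 1)) + 1` is at most twice the power, plus `1` for the block of length `2 ^ n`. -/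
lemma measureReal_chainingEvent_le (hX : ∀ n, 1 ≤ n → Measurable (X n))
    {C : ℝ} (hC : 0 ≤ C) (hvar : VarianceInequality μ X C) (hc : ∀ m, 0 < c m) (hcm : Monotone c)
    (ht : ∀ i, 1 ≤ i → ∀ m, μ.real {ω | c m < |X i ω|} ≤ t m) (hlam : ∀ m, 0 < lam m) (n : ℕ) :
    μ.real (chainingEvent μ X c lam n) ≤
      ∑ m ∈ Finset.range (n + 1), 7 * C * 2 ^ n *
        (c 0 ^ 2 + ∑ k ∈ Finset.range m, c (k + 1) ^ 2 * t k) / lam m ^ 2 + 2 ^ n * t n := by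
  set v : ℕ → ℝ := fun m => c 0 ^ 2 + ∑ k ∈ Finset.range m, c (k + 1) ^ 2 * t k with hv
  have ht0 : ∀ k, 0 ≤ t k := fun k => measureReal_nonneg.trans (ht 1 le_rfl k)
  have hv0 : ∀ m, 0 ≤ v m := fun m => add_nonneg (sq_nonneg _)
    (Finset.sum_nonneg fun k _ => mul_nonneg (sq_nonneg _) (ht0 k))
  have hw0 : ∀ m, 0 ≤ C * 2 ^ n * v m / lam m ^ 2 := fun m => by
    have := hv0 m; positivity
  have hblock : ∀ m, ∀ φ : ℝ → ℝ, Monotone φ → (∀ x, |φ x| ≤ min |x| (c m)) → ∀ k l, 1 ≤ l →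
      l ≤ 2 ^ m → μ.real (blockDeviation μ X φ k l (lam m)) ≤ C * 2 ^ m * v m / lam m ^ 2 := by
    intro m φ hmono hφ k l hl hl2
    refine (hvar.measureReal_block_le hX hC hc ht hmono hφ k hl (hlam m)).trans ?_
    have h2 : (l : ℝ) ≤ 2 ^ m := by exact_mod_cast hl2
    have := hv0 m
    show C * l * v m / lam m ^ 2 ≤ _
    gcongr
  have h1 : ∀ m ∈ Finset.range n, μ.real (⋃ s ∈ Finset.range (2 ^ (n - (m + 1)) + 1),
    ((blockDeviation μ X (clampAt (c m)) (s * 2 ^ (m + 1)) (2 ^ m) (lam (m + 1)) ∪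
      blockDeviation μ X (posIncrement (c m) (c (m + 1))) (s * 2 ^ (m + 1)) (2 ^ (m + 1))
        (lam (m + 1))) ∪
      blockDeviation μ X (negIncrement (c m) (c (m + 1))) (s * 2 ^ (m + 1)) (2 ^ (m + 1))
        (lam (m + 1)))) ≤ 6 * (C * 2 ^ n * v (m + 1) / lam (m + 1) ^ 2) := by
    intro m hm
    have hmn : m + 1 ≤ n := Finset.mem_range.1 hm
    have hcc := hcm (Nat.le_succ m)
    set w := C * 2 ^ (m + 1) * v (m + 1) / lam (m + 1) ^ 2 with hw
    have hw1 : 0 ≤ w := by have := hv0 (m + 1); positivity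
    have hpow : (2 : ℝ) ^ (n - (m + 1)) * 2 ^ (m + 1) = 2 ^ n := by
      rw [← pow_add, Nat.sub_add_cancel hmn]
    calc _ ≤ ∑ s ∈ Finset.range (2 ^ (n - (m + 1)) + 1), (w + w + w) := by
          refine (measureReal_biUnion_finset_le _ _).trans (Finset.sum_le_sum fun s _ => ?_)
          refine (measureReal_union_le _ _).trans (add_le_add
            ((measureReal_union_le _ _).trans (add_le_add ?_ ?_)) ?_)
          -- The truncation is at `c m` and the length is `2 ^ m`, but estimating both at level `m +
          -- 1` gives all three events the same bound `w`.
          · exact hblock (m + 1) _ (clampAt_monotone _) (fun x =>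
              (abs_clampAt_le (hc m).le x).trans (min_le_min le_rfl hcc)) _ _ Nat.one_le_two_pow
              (Nat.pow_le_pow_right (by norm_num) (Nat.le_succ m))
          · exact hblock (m + 1) _ (posIncrement_monotone (hc m).le hcc)
              (abs_posIncrement_le (hc m).le hcc) _ _ Nat.one_le_two_pow le_rfl
          · exact hblock (m + 1) _ (negIncrement_monotone (hc m).le hcc)
              (abs_negIncrement_le (hc m).le hcc) _ _ Nat.one_le_two_pow le_rfl
      _ = (2 ^ (n - (m + 1)) + 1) * (3 * w) := by
          rw [Finset.sum_const, Finset.card_range, nsmul_eq_mul]; push_cast; ring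
      _ ≤ (2 * 2 ^ (n - (m + 1))) * (3 * w) := by
          have : (1 : ℝ) ≤ 2 ^ (n - (m + 1)) := one_le_pow₀ (by norm_num)
          gcongr; linarith
      _ = 6 * (C * 2 ^ n * v (m + 1) / lam (m + 1) ^ 2) := by
          rw [hw, ← hpow]; ring
  have h2 : μ.real (⋃ i ∈ Finset.Icc 1 (2 ^ n), {ω | c n < |X i ω|}) ≤ 2 ^ n * t n := by
    refine (measureReal_biUnion_finset_le _ _).trans ((Finset.sum_le_sum fun i hi =>
      ht i (Finset.mem_Icc.1 hi).1 n).trans ?_)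
    simp
  have h3 := hblock n _ (clampAt_monotone (c n)) (abs_clampAt_le (hc n).le) 0 (2 ^ n)
    Nat.one_le_two_pow le_rfl
  have h4 : μ.real (chainingEvent μ X c lam n) ≤
      ∑ m ∈ Finset.range n, 6 * (C * 2 ^ n * v (m + 1) / lam (m + 1) ^ 2)
        + (C * 2 ^ n * v n / lam n ^ 2 + 2 ^ n * t n) :=
    (measureReal_union_le _ _).trans (add_le_add
      ((measureReal_biUnion_finset_le _ _).trans (Finset.sum_le_sum h1))
      ((measureReal_union_le _ _).trans (add_le_add h3 h2)))
  have h5 : ∑ m ∈ Finset.range n, 6 * (C * 2 ^ n * v (m + 1) / lam (m + 1) ^ 2)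
      ≤ ∑ m ∈ Finset.range (n + 1), 6 * (C * 2 ^ n * v m / lam m ^ 2) := by
    rw [Finset.sum_range_succ']
    exact le_add_of_nonneg_right (mul_nonneg (by norm_num) (hw0 0))
  have h6 : C * 2 ^ n * v n / lam n ^ 2
      ≤ ∑ m ∈ Finset.range (n + 1), C * 2 ^ n * v m / lam m ^ 2 :=
    Finset.single_le_sum (f := fun m => C * 2 ^ n * v m / lam m ^ 2) (fun m _ => hw0 m)
      (Finset.self_mem_range_succ n)
  have h7 : ∑ m ∈ Finset.range (n + 1), 7 * C * 2 ^ n * v m / lam m ^ 2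
      = ∑ m ∈ Finset.range (n + 1), 6 * (C * 2 ^ n * v m / lam m ^ 2)
        + ∑ m ∈ Finset.range (n + 1), C * 2 ^ n * v m / lam m ^ 2 := by
    rw [← Finset.sum_add_distrib]
    exact Finset.sum_congr rfl fun m _ => by ring
  show _ ≤ ∑ m ∈ Finset.range (n + 1), 7 * C * 2 ^ n * v m / lam m ^ 2 + _
  linarith

lemma abs_truncated_sum_le_of_notMem_chainingEvent (hX : ∀ n, 1 ≤ n → Measurable (X n))
    (hc : ∀ m, 0 < c m) (hcm : Monotone c)
    (ht : ∀ i, 1 ≤ i → ∀ m, μ.real {ω | c m < |X i ω|} ≤ t m) (hlam : ∀ m, 0 < lam m) {n : ℕ}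
    {ω : Ω} (hω : ω ∉ chainingEvent μ X c lam n) {j : ℕ} (hj : j ≤ 2 ^ n) :
    |∑ i ∈ Finset.Ioc 0 j, (clampAt (c n) (X i ω) - ∫ ω', clampAt (c n) (X i ω') ∂μ)| ≤
      ∑ m ∈ Finset.range n, (3 * lam (m + 1) + 2 ^ (m + 2) * (c (m + 1) * t m)) + lam n := by
  simp only [chainingEvent, Set.mem_union, Set.mem_iUnion, not_or, not_exists] at hω
  obtain ⟨h1, h2, -⟩ := hω
  have hdiv : ∀ m < n, j / 2 ^ (m + 1) ∈ Finset.range (2 ^ (n - (m + 1)) + 1) := by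
    intro m hm
    rw [Finset.mem_range, Nat.lt_succ_iff]
    calc j / 2 ^ (m + 1) ≤ 2 ^ n / 2 ^ (m + 1) := Nat.div_le_div_right hj
      _ = 2 ^ (n - (m + 1)) := Nat.pow_div (by omega) (by norm_num)
  have hA : ∀ m < n, |∑ i ∈ Finset.Ioc (j / 2 ^ (m + 1) * 2 ^ (m + 1)) (j / 2 ^ m * 2 ^ m),
      (clampAt (c m) (X i ω) - ∫ ω', clampAt (c m) (X i ω') ∂μ)| ≤ lam (m + 1) := by
    intro m hm
    -- The binary digit of `j` at position `m` is `0` or `1`.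
    have hcase : j / 2 ^ m * 2 ^ m = j / 2 ^ (m + 1) * 2 ^ (m + 1) ∨
        j / 2 ^ m * 2 ^ m = j / 2 ^ (m + 1) * 2 ^ (m + 1) + 2 ^ m := by
      rw [pow_succ, ← Nat.div_div_eq_div_mul, mul_comm (2 ^ m) 2, ← mul_assoc, ← add_one_mul]
      have : j / 2 ^ m / 2 * 2 = j / 2 ^ m ∨ j / 2 ^ m / 2 * 2 + 1 = j / 2 ^ m := by omega
      rcases this with h | h
      · left; rw [h]
      · right; rw [h]
    rcases hcase with h | h
    · rw [h]; simpa using (hlam _).le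
    · rw [h]
      exact le_of_notMem_blockDeviation (h1 m (Finset.mem_range.2 hm) _ (hdiv m hm)).1.1
  have hB : ∀ m < n, |∑ i ∈ Finset.Ioc (j / 2 ^ (m + 1) * 2 ^ (m + 1)) j,
      ((clampAt (c (m + 1)) (X i ω) - ∫ ω', clampAt (c (m + 1)) (X i ω') ∂μ)
        - (clampAt (c m) (X i ω) - ∫ ω', clampAt (c m) (X i ω') ∂μ))|
        ≤ 2 * lam (m + 1) + 2 ^ (m + 2) * (c (m + 1) * t m) := by
    intro m hm
    have hcc := hcm (Nat.le_succ m)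
    set a := j / 2 ^ (m + 1) * 2 ^ (m + 1) with ha
    have hja : j ≤ a + 2 ^ (m + 1) := by
      have := Nat.lt_div_mul_add (a := j) (b := 2 ^ (m + 1)) (by positivity)
      exact this.le
    have hP := le_of_notMem_blockDeviation (h1 m (Finset.mem_range.2 hm) _ (hdiv m hm)).1.2
    have hN := le_of_notMem_blockDeviation (h1 m (Finset.mem_range.2 hm) _ (hdiv m hm)).2
    rw [← ha] at hP hN
    -- With `D` the increment, `|D - E D| ≤ |D| + E|D| = (|D| - E|D|) + 2 E|D|`. The bracket is the
    -- centered positive part minus the centered negative part, and `E|D| ≤ c (m + 1) * t m`.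
    have hterm : ∀ i ∈ Finset.Ioc a (a + 2 ^ (m + 1)),
        |(clampAt (c (m + 1)) (X i ω) - ∫ ω', clampAt (c (m + 1)) (X i ω') ∂μ)
          - (clampAt (c m) (X i ω) - ∫ ω', clampAt (c m) (X i ω') ∂μ)| ≤
        (posIncrement (c m) (c (m + 1)) (X i ω)
            - ∫ ω', posIncrement (c m) (c (m + 1)) (X i ω') ∂μ)
          - (negIncrement (c m) (c (m + 1)) (X i ω)
            - ∫ ω', negIncrement (c m) (c (m + 1)) (X i ω') ∂μ) + 2 * (c (m + 1) * t m) := by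
      intro i hi
      have hi1 : 1 ≤ i := by have := Finset.mem_Ioc.1 hi; omega
      have hm1 := hX i hi1
      have i1 : Integrable (fun ω' => clampAt (c (m + 1)) (X i ω')) μ :=
        integrable_comp_of_monotone hm1 (clampAt_monotone _) (abs_clampAt_le (hc _).le)
      have i2 : Integrable (fun ω' => clampAt (c m) (X i ω')) μ :=
        integrable_comp_of_monotone hm1 (clampAt_monotone _) (abs_clampAt_le (hc _).le)
      have i3 : Integrable (fun ω' => posIncrement (c m) (c (m + 1)) (X i ω')) μ :=
        integrable_comp_of_monotone hm1 (posIncrement_monotone (hc m).le hcc)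
          (abs_posIncrement_le (hc m).le hcc)
      have i4 : Integrable (fun ω' => negIncrement (c m) (c (m + 1)) (X i ω')) μ :=
        integrable_comp_of_monotone hm1 (negIncrement_monotone (hc m).le hcc)
          (abs_negIncrement_le (hc m).le hcc)
      have e1 : ∫ ω', |clampAt (c (m + 1)) (X i ω') - clampAt (c m) (X i ω')| ∂μ
          = ∫ ω', posIncrement (c m) (c (m + 1)) (X i ω') ∂μ
            - ∫ ω', negIncrement (c m) (c (m + 1)) (X i ω') ∂μ := by
        simp only [abs_increment_eq]
        exact integral_sub i3 i4
      have e2 := integral_abs_clampAt_sub_le_of_tail hm1 (hc m).le hcc (ht i hi1 m)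
      have e3 : |∫ ω', clampAt (c (m + 1)) (X i ω') ∂μ - ∫ ω', clampAt (c m) (X i ω') ∂μ|
          ≤ ∫ ω', |clampAt (c (m + 1)) (X i ω') - clampAt (c m) (X i ω')| ∂μ := by
        rw [← integral_sub i1 i2]
        exact abs_integral_le_integral_abs
      have e4 := abs_increment_eq (c m) (c (m + 1)) (X i ω)
      rw [sub_sub_sub_comm]
      refine (abs_sub _ _).trans ?_
      linarith
    calc _ ≤ ∑ i ∈ Finset.Ioc a j,
          |(clampAt (c (m + 1)) (X i ω) - ∫ ω', clampAt (c (m + 1)) (X i ω') ∂μ)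
            - (clampAt (c m) (X i ω) - ∫ ω', clampAt (c m) (X i ω') ∂μ)| :=
          Finset.abs_sum_le_sum_abs _ _
      _ ≤ ∑ i ∈ Finset.Ioc a (a + 2 ^ (m + 1)),
          |(clampAt (c (m + 1)) (X i ω) - ∫ ω', clampAt (c (m + 1)) (X i ω') ∂μ)
            - (clampAt (c m) (X i ω) - ∫ ω', clampAt (c m) (X i ω') ∂μ)| :=
          -- The terms are now nonnegative, so the incomplete block may be completed.
          Finset.sum_le_sum_of_subset_of_nonneg (Finset.Ioc_subset_Ioc_right hja)
            fun _ _ _ => abs_nonneg _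
      _ ≤ _ := Finset.sum_le_sum hterm
      _ = ∑ i ∈ Finset.Ioc a (a + 2 ^ (m + 1)), (posIncrement (c m) (c (m + 1)) (X i ω)
            - ∫ ω', posIncrement (c m) (c (m + 1)) (X i ω') ∂μ)
          - ∑ i ∈ Finset.Ioc a (a + 2 ^ (m + 1)), (negIncrement (c m) (c (m + 1)) (X i ω)
            - ∫ ω', negIncrement (c m) (c (m + 1)) (X i ω') ∂μ)
          + 2 ^ (m + 2) * (c (m + 1) * t m) := by
          rw [Finset.sum_add_distrib, Finset.sum_sub_distrib, Finset.sum_const, Nat.card_Ioc,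
            Nat.add_sub_cancel_left, nsmul_eq_mul]
          push_cast; ring
      _ ≤ 2 * lam (m + 1) + 2 ^ (m + 2) * (c (m + 1) * t m) := by
          have := (abs_le.1 hP).2
          have := (abs_le.1 hN).1
          linarith
  have hchain := abs_sum_Ioc_le_chaining
    (fun m i => clampAt (c m) (X i ω) - ∫ ω', clampAt (c m) (X i ω') ∂μ) _ _ n j hA hB
  have hlast : |∑ i ∈ Finset.Ioc 0 (j / 2 ^ n * 2 ^ n),
      (clampAt (c n) (X i ω) - ∫ ω', clampAt (c n) (X i ω') ∂μ)| ≤ lam n := by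
    have hcase : j / 2 ^ n = 0 ∨ j / 2 ^ n = 1 := by
      have : j / 2 ^ n ≤ 2 ^ n / 2 ^ n := Nat.div_le_div_right hj
      rw [Nat.div_self (by positivity)] at this
      exact Nat.le_one_iff_eq_zero_or_eq_one.1 this
    rcases hcase with h | h
    · rw [h]; simpa using (hlam n).le
    · rw [h, one_mul]
      have := le_of_notMem_blockDeviation h2
      rwa [zero_add] at this
  rw [← Finset.sum_Ioc_consecutive _ (Nat.zero_le _) (Nat.div_mul_le_self j (2 ^ n))]
  refine (abs_add_le _ _).trans ?_
  have hsum : ∑ m ∈ Finset.range n, (3 * lam (m + 1) + 2 ^ (m + 2) * (c (m + 1) * t m))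
      = ∑ m ∈ Finset.range n, (lam (m + 1) + (2 * lam (m + 1) + 2 ^ (m + 2) * (c (m + 1) * t m))) :=
    Finset.sum_congr rfl fun m _ => by ring
  rw [hsum]
  linarith

lemma abs_sum_le_of_notMem_chainingEvent (hX : ∀ n, 1 ≤ n → Measurable (X n))
    (hc : ∀ m, 0 < c m) (hcm : Monotone c) (hctop : Tendsto c atTop atTop)
    (ht : ∀ i, 1 ≤ i → ∀ m, μ.real {ω | c m < |X i ω|} ≤ t m)
    (hs : Summable fun k => c (k + 1) * t k) (hlam : ∀ m, 0 < lam m) {n : ℕ}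
    {ω : Ω} (hω : ω ∉ chainingEvent μ X c lam n) {j : ℕ} (hj : j ≤ 2 ^ n) :
    |∑ i ∈ Finset.Icc 1 j, (X i ω - ∫ ω', X i ω' ∂μ)| ≤
      ∑ m ∈ Finset.range n, (3 * lam (m + 1) + 2 ^ (m + 2) * (c (m + 1) * t m)) + lam n
        + 2 ^ n * ∑' k, c (k + n + 1) * t (k + n) := by
  have h1 := abs_truncated_sum_le_of_notMem_chainingEvent hX hc hcm ht hlam hω hj
  have hIoc : Finset.Ioc 0 j = Finset.Icc 1 j := (Finset.Icc_add_one_left_eq_Ioc _ _).symm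
  rw [hIoc] at h1
  simp only [chainingEvent, Set.mem_union, Set.mem_iUnion, not_or, not_exists] at hω
  obtain ⟨-, -, h3⟩ := hω
  have ht0 : ∀ k, 0 ≤ t k := fun k => measureReal_nonneg.trans (ht 1 le_rfl k)
  have hR : 0 ≤ ∑' k, c (k + n + 1) * t (k + n) :=
    tsum_nonneg fun k => mul_nonneg (hc _).le (ht0 _)
  -- Off the event each `X i ω` equals its truncation at `c n`, so only the expectations differ.
  have hterm : ∀ i ∈ Finset.Icc 1 j, |(X i ω - ∫ ω', X i ω' ∂μ)
      - (clampAt (c n) (X i ω) - ∫ ω', clampAt (c n) (X i ω') ∂μ)|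
        ≤ ∑' k, c (k + n + 1) * t (k + n) := by
    intro i hi
    obtain ⟨hi1, hi2⟩ := Finset.mem_Icc.1 hi
    have hle : |X i ω| ≤ c n := not_lt.1 (h3 i (Finset.mem_Icc.2 ⟨hi1, hi2.trans hj⟩))
    rw [clampAt_eq_self hle, sub_sub_sub_cancel_left, abs_sub_comm, ← integral_sub
      (integrable_of_tail (hX i hi1) hc hctop (ht i hi1) hs)
      (integrable_comp_of_monotone (hX i hi1) (clampAt_monotone _) (abs_clampAt_le (hc n).le))]
    exact abs_integral_le_integral_abs.trans
      (integral_abs_sub_clampAt_le_of_tail (hX i hi1) hc hctop (ht i hi1) hs n)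
  have h4 : |∑ i ∈ Finset.Icc 1 j, (X i ω - ∫ ω', X i ω' ∂μ)
      - ∑ i ∈ Finset.Icc 1 j, (clampAt (c n) (X i ω) - ∫ ω', clampAt (c n) (X i ω') ∂μ)|
      ≤ 2 ^ n * ∑' k, c (k + n + 1) * t (k + n) := by
    rw [← Finset.sum_sub_distrib]
    refine (Finset.abs_sum_le_sum_abs _ _).trans ((Finset.sum_le_sum hterm).trans ?_)
    rw [Finset.sum_const, Nat.card_Icc, Nat.add_sub_cancel, nsmul_eq_mul]
    have : (j : ℝ) ≤ 2 ^ n := by exact_mod_cast hj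
    gcongr
  have h5 := abs_sub_abs_le_abs_sub (∑ i ∈ Finset.Icc 1 j, (X i ω - ∫ ω', X i ω' ∂μ))
    (∑ i ∈ Finset.Icc 1 j, (clampAt (c n) (X i ω) - ∫ ω', clampAt (c n) (X i ω') ∂μ))
  linarith

end Dyadic

/-! ### Series estimates for levels of geometric growth. -/

lemma summable_geometric_convolution {a : ℕ → ℝ} (ha0 : ∀ n, 0 ≤ a n) (ha : Summable a) {ρ : ℝ}
    (hρ0 : 0 ≤ ρ) (hρ : ρ < 1) :
    Summable fun n => ∑ k ∈ Finset.range (n + 1), a k * ρ ^ (n - k) := by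
  refine (summable_norm_sum_mul_range_of_summable_norm (f := a) (g := fun k => ρ ^ k)
    ha.norm (summable_geometric_of_lt_one hρ0 hρ).norm).congr fun n => ?_
  exact Real.norm_of_nonneg
    (Finset.sum_nonneg fun k _ => mul_nonneg (ha0 k) (pow_nonneg hρ0 _))

lemma geometric_sum_range_reflect_le {s : ℝ} (hs0 : 0 ≤ s) (hs : s < 1) (n : ℕ) :
    ∑ m ∈ Finset.range (n + 1), s ^ (n - m) ≤ (1 - s)⁻¹ := by
  have h := Finset.sum_range_reflect (fun k => s ^ k) (n + 1)
  rw [Nat.add_sub_cancel] at h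
  rw [h, ← tsum_geometric_of_lt_one hs0 hs]
  exact (summable_geometric_of_lt_one hs0 hs).sum_le_tsum _ fun k _ => pow_nonneg hs0 k

section Growth

variable {c : ℕ → ℝ} {q r : ℝ}

lemma geometric_growth_lower (hr : 0 ≤ r) (hcr : ∀ m, r * c m ≤ c (m + 1)) (m k : ℕ) :
    r ^ k * c m ≤ c (m + k) := by
  induction k with
  | zero => simp
  | succ k ih =>
    calc r ^ (k + 1) * c m = r * (r ^ k * c m) := by ring
      _ ≤ r * c (m + k) := mul_le_mul_of_nonneg_left ih hr
      _ ≤ c (m + (k + 1)) := hcr _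

lemma geometric_growth_upper (hq : 0 ≤ q) (hcq : ∀ m, c (m + 1) ≤ q * c m) (m k : ℕ) :
    c (m + k) ≤ q ^ k * c m := by
  induction k with
  | zero => simp
  | succ k ih =>
    calc c (m + (k + 1)) ≤ q * c (m + k) := hcq _
      _ ≤ q * (q ^ k * c m) := mul_le_mul_of_nonneg_left ih hq
      _ = q ^ (k + 1) * c m := by ring

variable {a : ℕ → ℝ}

lemma summable_mul_div_pow (hq : 0 < q) (hc : ∀ m, 0 < c m) (hcq : ∀ m, c (m + 1) ≤ q * c m)
    (ha0 : ∀ n, 0 ≤ a n) (ha : Summable a) : Summable fun k => c (k + 1) * (a k / q ^ k) := by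
  refine Summable.of_nonneg_of_le (fun k => mul_nonneg (hc _).le (div_nonneg (ha0 k)
    (pow_nonneg hq.le _))) (fun k => ?_) (ha.mul_left (q * c 0))
  have h := geometric_growth_upper hq.le hcq 0 (k + 1)
  rw [zero_add] at h
  calc c (k + 1) * (a k / q ^ k) ≤ q ^ (k + 1) * c 0 * (a k / q ^ k) :=
        mul_le_mul_of_nonneg_right h (div_nonneg (ha0 k) (pow_nonneg hq.le _))
    _ = q * c 0 * a k := by field_simp; ring

/-- From `c (k + n + 1) ≤ q ^ (k + 1) * c n`, the quotient is at most `q * (2 / q) ^ n` times a tail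
of `∑ a`, and `q ≥ 2`. -/
lemma tendsto_tail_expectation (hq : 2 ≤ q) (hc : ∀ m, 0 < c m) (hcq : ∀ m, c (m + 1) ≤ q * c m)
    (ha0 : ∀ n, 0 ≤ a n) (ha : Summable a) :
    Tendsto (fun n => 2 ^ n * (∑' k, c (k + n + 1) * (a (k + n) / q ^ (k + n))) / c n) atTop
      (𝓝 0) := by
  have hq0 : 0 < q := by linarith
  have hlim : Tendsto (fun n => q * ∑' k, a (k + n)) atTop (𝓝 0) := by
    simpa using (tendsto_sum_nat_add a).const_mul q
  have hnn : ∀ k n, 0 ≤ c (k + n + 1) * (a (k + n) / q ^ (k + n)) := fun k n =>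
    mul_nonneg (hc _).le (div_nonneg (ha0 _) (pow_nonneg hq0.le _))
  refine squeeze_zero (fun n => div_nonneg (mul_nonneg (by positivity)
    (tsum_nonneg fun k => hnn k n)) (hc n).le) (fun n => ?_) hlim
  rw [div_le_iff₀ (hc n)]
  have hterm : ∀ k, c (k + n + 1) * (a (k + n) / q ^ (k + n)) ≤ q * c n / q ^ n * a (k + n) := by
    intro k
    have h := geometric_growth_upper hq0.le hcq n (k + 1)
    rw [show n + (k + 1) = k + n + 1 by ring] at h
    calc c (k + n + 1) * (a (k + n) / q ^ (k + n))
        ≤ q ^ (k + 1) * c n * (a (k + n) / q ^ (k + n)) :=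
          mul_le_mul_of_nonneg_right h (div_nonneg (ha0 _) (pow_nonneg hq0.le _))
      _ = q * c n / q ^ n * a (k + n) := by rw [pow_add q k n, pow_succ]; field_simp
  have hsa : Summable fun k => a (k + n) := (summable_nat_add_iff n).2 ha
  have h1 : ∑' k, c (k + n + 1) * (a (k + n) / q ^ (k + n))
      ≤ q * c n / q ^ n * ∑' k, a (k + n) := by
    rw [← tsum_mul_left]
    exact (Summable.of_nonneg_of_le (fun k => hnn k n) hterm (hsa.mul_left _)).tsum_le_tsum hterm
      (hsa.mul_left _)
  have h2 : (2 : ℝ) ^ n ≤ q ^ n := pow_le_pow_left₀ (by norm_num) hq n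
  have h3 : 0 ≤ q * c n * ∑' k, a (k + n) :=
    mul_nonneg (mul_nonneg hq0.le (hc n).le) (tsum_nonneg fun k => ha0 _)
  calc 2 ^ n * (∑' k, c (k + n + 1) * (a (k + n) / q ^ (k + n)))
      ≤ 2 ^ n * (q * c n / q ^ n * ∑' k, a (k + n)) :=
        mul_le_mul_of_nonneg_left h1 (by positivity)
    _ = 2 ^ n / q ^ n * (q * c n * ∑' k, a (k + n)) := by ring
    _ ≤ 1 * (q * c n * ∑' k, a (k + n)) :=
        mul_le_mul_of_nonneg_right ((div_le_one (by positivity)).2 h2) h3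
    _ = q * (∑' k, a (k + n)) * c n := by ring

/-- Since `2 ^ m ≤ q ^ m` and `c` grows at least like powers of `r`, the quotient is bounded by a
convolution of `a` with a geometric sequence, which is summable and so tends to zero. -/
lemma tendsto_head_expectation (hq : 2 ≤ q) (hr : 1 < r) (hc : ∀ m, 0 < c m)
    (hcr : ∀ m, r * c m ≤ c (m + 1)) (ha0 : ∀ n, 0 ≤ a n) (ha : Summable a) :
    Tendsto (fun n => (∑ m ∈ Finset.range n, 2 ^ (m + 2) * (c (m + 1) * (a m / q ^ m))) / c n)
      atTop (𝓝 0) := by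
  have hr0 : 0 < r := by linarith
  have hq0 : 0 < q := by linarith
  rw [← tendsto_add_atTop_iff_nat 1]
  have hlim : Tendsto (fun n => 4 * ∑ k ∈ Finset.range (n + 1), a k * r⁻¹ ^ (n - k)) atTop
      (𝓝 0) := by
    simpa using (summable_geometric_convolution ha0 ha (inv_nonneg.2 hr0.le)
      (inv_lt_one_of_one_lt₀ hr)).tendsto_atTop_zero.const_mul 4
  refine squeeze_zero (fun n => div_nonneg (Finset.sum_nonneg fun m _ => ?_) (hc _).le)
    (fun n => ?_) hlim
  · have := ha0 m
    have := hc (m + 1)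
    positivity
  rw [Finset.sum_div, Finset.mul_sum]
  refine Finset.sum_le_sum fun m hm => ?_
  have hmn : m ≤ n := Nat.lt_succ_iff.1 (Finset.mem_range.1 hm)
  have h1 := geometric_growth_lower hr0.le hcr (m + 1) (n - m)
  rw [show m + 1 + (n - m) = n + 1 by omega] at h1
  have h2 : (2 : ℝ) ^ m ≤ q ^ m := pow_le_pow_left₀ (by norm_num) hq m
  have h3 : c (m + 1) / c (n + 1) ≤ r⁻¹ ^ (n - m) := by
    rw [inv_pow, div_le_iff₀ (hc _), inv_mul_eq_div, le_div_iff₀ (by positivity)]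
    linarith
  have h4 : (2 : ℝ) ^ m / q ^ m ≤ 1 := (div_le_one (by positivity)).2 h2
  have h5 : 0 ≤ c (m + 1) / c (n + 1) := div_nonneg (hc _).le (hc _).le
  calc 2 ^ (m + 2) * (c (m + 1) * (a m / q ^ m)) / c (n + 1)
      = 4 * (a m * (c (m + 1) / c (n + 1) * (2 ^ m / q ^ m))) := by rw [pow_add]; ring
    _ ≤ 4 * (a m * (r⁻¹ ^ (n - m) * 1)) := by
        have := ha0 m
        gcongr
    _ = 4 * (a m * r⁻¹ ^ (n - m)) := by ring

/-- Since `c m ≥ r ^ (m - k) * c k`, moving from `k` to `m` gains a factor `(q / r ^ 2) ^ (m - k)`.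
The series is thus dominated by a geometric series plus a convolution of `a` with one. -/
lemma summable_truncated_second_moment (hr : 0 < r) (hqr : q < r ^ 2)
    (hq : 0 < q) (hc : ∀ m, 0 < c m) (hcr : ∀ m, r * c m ≤ c (m + 1))
    (hcq : ∀ m, c (m + 1) ≤ q * c m) (ha0 : ∀ n, 0 ≤ a n) (ha : Summable a) :
    Summable fun m => q ^ m / c m ^ 2 *
      (c 0 ^ 2 + ∑ k ∈ Finset.range m, c (k + 1) ^ 2 * (a k / q ^ k)) := by
  set κ := q / r ^ 2 with hκ
  have hκ0 : 0 ≤ κ := by positivity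
  have hκ1 : κ < 1 := (div_lt_one (by positivity)).2 hqr
  have hratio : ∀ k m, k ≤ m → c k ^ 2 * (q ^ m / c m ^ 2) ≤ q ^ k * κ ^ (m - k) := by
    intro k m hkm
    have h1 := geometric_growth_lower hr.le hcr k (m - k)
    rw [Nat.add_sub_cancel' hkm] at h1
    have h2 : (r ^ (m - k) * c k) ^ 2 ≤ c m ^ 2 :=
      pow_le_pow_left₀ (mul_nonneg (by positivity) (hc k).le) h1 2
    have h3 : q ^ m = q ^ k * q ^ (m - k) := by rw [← pow_add, Nat.add_sub_cancel' hkm]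
    have hcm := hc m
    have hck := hc k
    rw [h3, hκ, div_pow, ← pow_mul, mul_comm 2, pow_mul]
    rw [mul_div_assoc', mul_div_assoc', div_le_div_iff₀ (by positivity) (by positivity)]
    calc c k ^ 2 * (q ^ k * q ^ (m - k)) * (r ^ (m - k)) ^ 2
        = q ^ k * q ^ (m - k) * (r ^ (m - k) * c k) ^ 2 := by ring
      _ ≤ q ^ k * q ^ (m - k) * c m ^ 2 := mul_le_mul_of_nonneg_left h2 (by positivity)
  refine Summable.of_nonneg_of_le (fun m => ?_) (fun m => ?_)
    ((summable_geometric_of_lt_one hκ0 hκ1).add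
      ((summable_geometric_convolution ha0 ha hκ0 hκ1).mul_left (q ^ 2)))
  · have : 0 ≤ ∑ k ∈ Finset.range m, c (k + 1) ^ 2 * (a k / q ^ k) :=
      Finset.sum_nonneg fun k _ => mul_nonneg (sq_nonneg _) (div_nonneg (ha0 k) (by positivity))
    positivity
  · rw [mul_add, Finset.mul_sum]
    refine add_le_add ?_ ?_
    · have := hratio 0 m (Nat.zero_le _)
      rw [pow_zero, one_mul, Nat.sub_zero] at this
      linarith
    · rw [Finset.mul_sum]
      refine (Finset.sum_le_sum (g := fun k => q ^ 2 * (a k * κ ^ (m - k))) fun k hk => ?_).trans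
        (Finset.sum_le_sum_of_subset_of_nonneg (Finset.range_subset_range.2 (Nat.le_succ m))
          fun k _ _ => mul_nonneg (sq_nonneg _) (mul_nonneg (ha0 k) (pow_nonneg hκ0 _)))
      have hkm := (Finset.mem_range.1 hk).le
      have h1 := hratio k m hkm
      have h2 : c (k + 1) ^ 2 ≤ (q * c k) ^ 2 := pow_le_pow_left₀ (hc _).le (hcq k) 2
      have hak := ha0 k
      calc q ^ m / c m ^ 2 * (c (k + 1) ^ 2 * (a k / q ^ k))
          ≤ q ^ m / c m ^ 2 * ((q * c k) ^ 2 * (a k / q ^ k)) := by gcongr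
        _ = q ^ 2 * (a k / q ^ k) * (c k ^ 2 * (q ^ m / c m ^ 2)) := by ring
        _ ≤ q ^ 2 * (a k / q ^ k) * (q ^ k * κ ^ (m - k)) := by gcongr
        _ = q ^ 2 * (a k * κ ^ (m - k)) := by field_simp

end Growth

/-! ### Complete convergence along powers of two. -/

section Core

variable {Ω : Type*} [MeasurableSpace Ω] {μ : Measure Ω} [IsProbabilityMeasure μ]
  {X : ℕ → Ω → ℝ} {c a : ℕ → ℝ} {q r : ℝ}

lemma summable_measureReal_chainingEvent (hX : ∀ n, 1 ≤ n → Measurable (X n))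
    {C : ℝ} (hC : 0 ≤ C) (hvar : VarianceInequality μ X C)
    (hq : 2 ≤ q) (hr : 1 < r) (hqr : q < r ^ 2) (hc : ∀ m, 0 < c m)
    (hcr : ∀ m, r * c m ≤ c (m + 1)) (hcq : ∀ m, c (m + 1) ≤ q * c m)
    (ha0 : ∀ n, 0 ≤ a n) (ha : Summable a)
    (ht : ∀ i, 1 ≤ i → ∀ m, μ.real {ω | c m < |X i ω|} ≤ a m / q ^ m)
    {s η : ℝ} (hs0 : 0 < s) (hs : q < (r * s) ^ 2) (hη : 0 < η) :
    Summable fun n => (q / 2) ^ n *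
      μ.real (chainingEvent μ X c (fun m => η * c n * s ^ (n - m)) n) := by
  have hr0 : 0 < r := by linarith
  have hq0 : 0 < q := by linarith
  have hcm : Monotone c := monotone_nat_of_le_succ fun m =>
    (le_mul_of_one_le_left (hc m).le hr.le).trans (hcr m)
  set v : ℕ → ℝ := fun m => c 0 ^ 2 + ∑ k ∈ Finset.range m, c (k + 1) ^ 2 * (a k / q ^ k) with hv
  have hv0 : ∀ m, 0 ≤ v m := fun m => add_nonneg (sq_nonneg _) (Finset.sum_nonneg fun k _ =>
    mul_nonneg (sq_nonneg _) (div_nonneg (ha0 k) (by positivity)))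
  have hV := summable_truncated_second_moment hr0 hqr hq0 hc hcr hcq ha0 ha
  set θ := q / (r * s) ^ 2 with hθ
  have hθ0 : 0 ≤ θ := by positivity
  have hθ1 : θ < 1 := (div_lt_one (by positivity)).2 hs
  have hu0 : ∀ m, 0 ≤ q ^ m / c m ^ 2 * v m := fun m => mul_nonneg (by positivity) (hv0 m)
  refine Summable.of_nonneg_of_le (fun n => by positivity) (fun n => ?_)
    (((summable_geometric_convolution hu0 hV hθ0 hθ1).mul_left (7 * C / η ^ 2)).add ha)
  have hlam : ∀ m, 0 < η * c n * s ^ (n - m) := fun m => by have := hc n; positivity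
  have hbound := measureReal_chainingEvent_le hX hC hvar hc hcm ht hlam n
  -- Replacing `c n` by `r ^ (n - m) * c m` leaves the summable term at `m` times `θ ^ (n - m)`.
  have hterm : ∀ m ∈ Finset.range (n + 1), (q / 2) ^ n * (7 * C * 2 ^ n * v m /
      (η * c n * s ^ (n - m)) ^ 2) ≤ 7 * C / η ^ 2 * (q ^ m / c m ^ 2 * v m * θ ^ (n - m)) := by
    intro m hm
    have hmn : m ≤ n := Nat.lt_succ_iff.1 (Finset.mem_range.1 hm)
    have h1 := geometric_growth_lower hr0.le hcr m (n - m)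
    rw [Nat.add_sub_cancel' hmn] at h1
    have h2 : (r ^ (n - m) * c m) ^ 2 ≤ c n ^ 2 :=
      pow_le_pow_left₀ (mul_nonneg (by positivity) (hc m).le) h1 2
    have h3 : q ^ n = q ^ m * q ^ (n - m) := by rw [← pow_add, Nat.add_sub_cancel' hmn]
    have hvm := hv0 m
    have hcm' := hc m
    have hcn := hc n
    calc (q / 2) ^ n * (7 * C * 2 ^ n * v m / (η * c n * s ^ (n - m)) ^ 2)
        = 7 * C / η ^ 2 * v m * q ^ m * (q ^ (n - m) / (s ^ (n - m)) ^ 2) * (1 / c n ^ 2) := by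
          rw [div_pow, h3]; field_simp
      _ ≤ 7 * C / η ^ 2 * v m * q ^ m * (q ^ (n - m) / (s ^ (n - m)) ^ 2)
            * (1 / (r ^ (n - m) * c m) ^ 2) := by gcongr
      _ = 7 * C / η ^ 2 * (q ^ m / c m ^ 2 * v m * θ ^ (n - m)) := by
          rw [hθ, div_pow, pow_right_comm (r * s), mul_pow r s]; field_simp
  calc _ ≤ (q / 2) ^ n * (∑ m ∈ Finset.range (n + 1), 7 * C * 2 ^ n * v m /
          (η * c n * s ^ (n - m)) ^ 2 + 2 ^ n * (a n / q ^ n)) :=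
        mul_le_mul_of_nonneg_left hbound (by positivity)
    _ = ∑ m ∈ Finset.range (n + 1), (q / 2) ^ n * (7 * C * 2 ^ n * v m /
          (η * c n * s ^ (n - m)) ^ 2) + a n := by
        rw [mul_add, Finset.mul_sum, div_pow]
        congr 1
        field_simp
    _ ≤ _ := by
        rw [Finset.mul_sum]
        exact add_le_add (Finset.sum_le_sum hterm) le_rfl

/-- Dyadic form of the maximal law: complete convergence along `2 ^ n` for levels `c n` of
geometric growth. -/
theorem summable_measureReal_dyadic_max (hX : ∀ n, 1 ≤ n → Measurable (X n))
    {C : ℝ} (hC : 0 ≤ C) (hvar : VarianceInequality μ X C)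
    (hq : 2 ≤ q) (hr : 1 < r) (hqr : q < r ^ 2) (hc : ∀ m, 0 < c m)
    (hcr : ∀ m, r * c m ≤ c (m + 1)) (hcq : ∀ m, c (m + 1) ≤ q * c m)
    (ha0 : ∀ n, 0 ≤ a n) (ha : Summable a)
    (ht : ∀ i, 1 ≤ i → ∀ m, μ.real {ω | c m < |X i ω|} ≤ a m / q ^ m) {ε : ℝ} (hε : 0 < ε) :
    Summable fun n : ℕ => (q / 2) ^ n *
      μ.real {ω | ∃ j ≤ 2 ^ n, ε * c n < |∑ i ∈ Finset.Icc 1 j, (X i ω - ∫ ω', X i ω' ∂μ)|} := by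
  have hr0 : 0 < r := by linarith
  have hq0 : 0 < q := by linarith
  have hcm : Monotone c := monotone_nat_of_le_succ fun m =>
    (le_mul_of_one_le_left (hc m).le hr.le).trans (hcr m)
  have hctop : Tendsto c atTop atTop := by
    refine tendsto_atTop_mono (fun n => ?_)
      ((tendsto_pow_atTop_atTop_of_one_lt hr).atTop_mul_const (hc 0))
    simpa using geometric_growth_lower hr0.le hcr 0 n
  -- `s < 1` makes the allowed deviations summable over scales, and `s > √q / r` keeps the
  -- probabilities summable. Such `s` exists because `q < r ^ 2`.
  obtain ⟨s, hs1, hs2⟩ : ∃ s, Real.sqrt q / r < s ∧ s < 1 :=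
    exists_between ((div_lt_one hr0).2 ((Real.sqrt_lt' hr0).2 hqr))
  have hs0 : 0 < s := lt_of_le_of_lt (by positivity) hs1
  have hs : q < (r * s) ^ 2 := by
    rw [div_lt_iff₀ hr0, mul_comm] at hs1
    exact Real.lt_sq_of_sqrt_lt hs1
  -- The deviations enter with total weight `3 + 1 = 4`, each part at most `ε / 8 * c k`; the other
  -- half of `ε` is left for the expectations.
  set η := ε * (1 - s) / 8 with hη_def
  have hη : 0 < η := by have : 0 < 1 - s := by linarith
                        positivity
  have hsum := summable_measureReal_chainingEvent hX hC hvar hq hr hqr hc hcr hcq ha0 ha ht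
    hs0 hs hη
  have hsmall := ((tendsto_head_expectation hq hr hc hcr ha0 ha).add
    (tendsto_tail_expectation hq hc hcq ha0 ha)).eventually (gt_mem_nhds
      (show (0 : ℝ) + 0 < ε / 2 by linarith))
  obtain ⟨N, hN⟩ := eventually_atTop.1 hsmall
  rw [← summable_nat_add_iff N] at hsum ⊢
  refine Summable.of_nonneg_of_le (fun n => by positivity) (fun n => ?_) hsum
  generalize hk : n + N = k
  refine mul_le_mul_of_nonneg_left (measureReal_mono ?_) (by positivity)
  rintro ω ⟨j, hj, hlt⟩
  by_contra hω
  have hck := hc k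
  have hlam : ∀ m, 0 < η * c k * s ^ (k - m) := fun m => by positivity
  have h1 := abs_sum_le_of_notMem_chainingEvent hX hc hcm hctop ht
    (summable_mul_div_pow hq0 hc hcq ha0 ha) hlam hω hj
  have h2 := hN k (by omega)
  rw [← add_div, div_lt_iff₀ hck] at h2
  have h3 : ∑ m ∈ Finset.range (k + 1), η * c k * s ^ (k - m) ≤ ε / 8 * c k := by
    rw [← Finset.mul_sum]
    refine (mul_le_mul_of_nonneg_left (geometric_sum_range_reflect_le hs0.le hs2 k)
      (by positivity)).trans_eq ?_
    have : 1 - s ≠ 0 := by linarith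
    rw [hη_def]; field_simp
  have h4 : ∑ m ∈ Finset.range k, η * c k * s ^ (k - (m + 1))
      ≤ ∑ m ∈ Finset.range (k + 1), η * c k * s ^ (k - m) := by
    rw [Finset.sum_range_succ']
    exact le_add_of_nonneg_right (hlam 0).le
  have h5 : η * c k * s ^ (k - k) ≤ ∑ m ∈ Finset.range (k + 1), η * c k * s ^ (k - m) :=
    Finset.single_le_sum (f := fun m => η * c k * s ^ (k - m)) (fun m _ => (hlam m).le)
      (Finset.self_mem_range_succ k)
  rw [Finset.sum_add_distrib, ← Finset.mul_sum] at h1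
  linarith

end Core

/-! ### Inverting `x * L x` and comparing with the de Bruijn conjugate. -/

section SlowVariation

variable {L : ℝ → ℝ}

lemma IsSlowlyVarying.eventually_pos (hL : IsSlowlyVarying L) : ∀ᶠ x in atTop, 0 < L x := by
  obtain ⟨A, -, hA, -⟩ := hL.pos_measurable
  filter_upwards [eventually_ge_atTop A] with x hx using hA x hx

lemma IsSlowlyVarying.tendsto_mul_ratio (hL : IsSlowlyVarying L) {b : ℝ} (hb : 0 < b) :
    Tendsto (fun x => b * x * L (b * x) / (x * L x)) atTop (𝓝 b) := by
  have h := (hL.tendsto_ratio b hb).const_mul b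
  rw [Real.rpow_zero, mul_one] at h
  refine h.congr' ?_
  filter_upwards [eventually_gt_atTop 0] with x hx
  field_simp

/-- A normalized slowly varying `L` makes `x ↦ x * L x` continuous and strictly increasing near
infinity. -/
lemma IsNormalized.exists_strictMonoOn (hreg : IsNormalized L) (hL : IsSlowlyVarying L) :
    ∃ x₀, 0 < x₀ ∧ (∀ x, x₀ ≤ x → 0 < L x) ∧ StrictMonoOn (fun x => x * L x) (Set.Ici x₀) ∧
      ContinuousOn (fun x => x * L x) (Set.Ici x₀) := by
  obtain ⟨A, hA0, hA⟩ := hreg.differentiable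
  have h1 := hreg.tendsto_log_deriv.eventually (lt_mem_nhds (show (-1 : ℝ) < 0 by norm_num))
  obtain ⟨B, hB⟩ := eventually_atTop.1 (h1.and hL.eventually_pos)
  refine ⟨max A B, lt_max_of_lt_left hA0, fun x hx => (hB x ((le_max_right _ _).trans hx)).2,
    ?_, ?_⟩
  · refine strictMonoOn_of_deriv_pos (convex_Ici _) ?_ fun x hx => ?_
    · intro x hx
      exact (continuousAt_id.mul
        (hA x ((le_max_left _ _).trans hx)).continuousAt).continuousWithinAt
    · rw [interior_Ici] at hx
      have hx' : max A B < x := hx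
      obtain ⟨h2, h3⟩ := hB x ((le_max_right _ _).trans hx'.le)
      have hd := hA x ((le_max_left _ _).trans hx'.le)
      have hderiv : HasDerivAt (fun x => x * L x) (1 * L x + x * deriv L x) x :=
        (hasDerivAt_id x).mul hd.hasDerivAt
      rw [hderiv.deriv]
      rw [lt_div_iff₀ h3] at h2
      linarith
  · intro x hx
    exact (continuousAt_id.mul (hA x ((le_max_left _ _).trans hx)).continuousAt).continuousWithinAt

/-- Doubling `x` eventually multiplies `x * L x` by at least `3 / 2`, so it is unbounded along `2 ^
k * x₁`; monotonicity fills the gaps. -/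
lemma IsSlowlyVarying.tendsto_mul_atTop (hL : IsSlowlyVarying L) {x₀ : ℝ} (hx₀ : 0 < x₀)
    (hpos : ∀ x, x₀ ≤ x → 0 < L x) (hmono : StrictMonoOn (fun x => x * L x) (Set.Ici x₀)) :
    Tendsto (fun x => x * L x) atTop atTop := by
  have h1 := (hL.tendsto_mul_ratio (b := 2) (by norm_num)).eventually
    (lt_mem_nhds (show (3 / 2 : ℝ) < 2 by norm_num))
  obtain ⟨B, hB⟩ := eventually_atTop.1 h1
  set x₁ := max x₀ B with hx₁
  have hx₁0 : 0 < x₁ := lt_max_of_lt_left hx₀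
  have hge : ∀ k : ℕ, x₁ ≤ 2 ^ k * x₁ := fun k =>
    le_mul_of_one_le_left hx₁0.le (one_le_pow₀ (by norm_num))
  have hpow : ∀ k : ℕ, (3 / 2 : ℝ) ^ k * (x₁ * L x₁) ≤ 2 ^ k * x₁ * L (2 ^ k * x₁) := by
    intro k
    induction k with
    | zero => simp
    | succ k ih =>
      have h2 := hB _ ((le_max_right x₀ B).trans (hge k))
      have h3 : 0 < 2 ^ k * x₁ * L (2 ^ k * x₁) :=
        mul_pos (by positivity) (hpos _ ((le_max_left x₀ B).trans (hge k)))
      rw [lt_div_iff₀ h3] at h2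
      calc (3 / 2 : ℝ) ^ (k + 1) * (x₁ * L x₁) = 3 / 2 * ((3 / 2) ^ k * (x₁ * L x₁)) := by ring
        _ ≤ 3 / 2 * (2 ^ k * x₁ * L (2 ^ k * x₁)) := by gcongr
        _ ≤ 2 * (2 ^ k * x₁) * L (2 * (2 ^ k * x₁)) := h2.le
        _ = 2 ^ (k + 1) * x₁ * L (2 ^ (k + 1) * x₁) := by rw [pow_succ]; ring_nf
  have htop : Tendsto (fun k : ℕ => (3 / 2 : ℝ) ^ k * (x₁ * L x₁)) atTop atTop :=
    (tendsto_pow_atTop_atTop_of_one_lt (by norm_num)).atTop_mul_const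
      (mul_pos hx₁0 (hpos _ (le_max_left _ _)))
  rw [tendsto_atTop]
  intro b
  obtain ⟨k, hk⟩ := (htop.eventually_ge_atTop b).exists
  filter_upwards [eventually_ge_atTop (2 ^ k * x₁)] with x hx
  have h4 : x₀ ≤ 2 ^ k * x₁ := (le_max_left x₀ B).trans (hge k)
  exact hk.trans ((hpow k).trans (hmono.monotoneOn h4 (h4.trans hx) hx))

/-- The inverse function near infinity of `x ↦ x * L x`. -/
lemma IsNormalized.exists_inverse (hreg : IsNormalized L) (hL : IsSlowlyVarying L) :
    ∃ (x₀ : ℝ) (γ : ℝ → ℝ), 0 < x₀ ∧ (∀ x, x₀ ≤ x → 0 < L x) ∧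
      StrictMonoOn (fun x => x * L x) (Set.Ici x₀) ∧
      (∀ y, x₀ * L x₀ ≤ y → x₀ ≤ γ y ∧ γ y * L (γ y) = y) ∧ Tendsto γ atTop atTop := by
  obtain ⟨x₀, hx₀, hpos, hmono, hcont⟩ := hreg.exists_strictMonoOn hL
  have htop := hL.tendsto_mul_atTop hx₀ hpos hmono
  have hex : ∀ y, ∃ x, x₀ * L x₀ ≤ y → x₀ ≤ x ∧ x * L x = y := by
    intro y
    by_cases hy : x₀ * L x₀ ≤ y
    · obtain ⟨z, hz1, hz2⟩ := ((htop.eventually_ge_atTop y).and (eventually_ge_atTop x₀)).exists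
      obtain ⟨x, hx, hxy⟩ := intermediate_value_Icc hz2 (hcont.mono Set.Icc_subset_Ici_self)
        (Set.mem_Icc.2 ⟨hy, hz1⟩)
      exact ⟨x, fun _ => ⟨hx.1, hxy⟩⟩
    · exact ⟨0, fun h => absurd h hy⟩
  choose γ hγ using hex
  refine ⟨x₀, γ, hx₀, hpos, hmono, hγ, ?_⟩
  rw [tendsto_atTop]
  intro b
  filter_upwards [eventually_ge_atTop (x₀ * L x₀),
    eventually_ge_atTop (max x₀ b * L (max x₀ b))] with y hy hy2
  obtain ⟨h1, h2⟩ := hγ y hy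
  refine (le_max_right x₀ b).trans
    ((hmono.le_iff_le (Set.mem_Ici.2 (le_max_left x₀ b)) h1).1 ?_)
  rw [h2]; exact hy2

/-- Evaluating the conjugacy relation at `x = γ y` gives `L (γ y) * Lt y → 1`; multiplying by `γ y`
gives `y * Lt y ~ γ y`. -/
lemma IsDeBruijnConjugate.eventually_inverse_le {Lt γ : ℝ → ℝ} {y₀ : ℝ}
    (hLt : IsDeBruijnConjugate L Lt) (hγ : ∀ y, y₀ ≤ y → γ y * L (γ y) = y)
    (hγtop : Tendsto γ atTop atTop) : ∀ᶠ y in atTop, γ y / 2 ≤ y * Lt y := by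
  have h1 := (hLt.tendsto_left.comp hγtop).eventually
    (lt_mem_nhds (show (1 / 2 : ℝ) < 1 by norm_num))
  filter_upwards [h1, eventually_ge_atTop y₀, hγtop.eventually_gt_atTop 0] with y hy hy0 hpos
  simp only [Function.comp, hγ y hy0] at hy
  calc γ y / 2 = γ y * (1 / 2) := by ring
    _ ≤ γ y * (L (γ y) * Lt y) := mul_le_mul_of_nonneg_left hy.le hpos.le
    _ = y * Lt y := by rw [← mul_assoc, hγ y hy0]

end SlowVariation

/-! ### Summability of the reciprocal logarithmic weight. -/

section Log

lemma one_le_truncLog (x : ℝ) : 1 ≤ truncLog x := by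
  rw [truncLog, Real.le_log_iff_exp_le (lt_max_of_lt_right (Real.exp_pos 1))]
  exact le_max_right _ _

lemma truncLog_mono : Monotone truncLog := fun _ _ h =>
  Real.log_le_log (lt_max_of_lt_right (Real.exp_pos 1)) (max_le_max h le_rfl)

lemma log_le_truncLog {x : ℝ} (hx : 0 < x) : Real.log x ≤ truncLog x :=
  Real.log_le_log hx (le_max_left _ _)

/-- The logarithmic weight `log x * (log log x) ^ 2`. -/
noncomputable def logWeight (x : ℝ) : ℝ := truncLog x * truncLog (truncLog x) ^ 2

lemma one_le_logWeight (x : ℝ) : 1 ≤ logWeight x :=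
  one_le_mul_of_one_le_of_one_le (one_le_truncLog x) (one_le_pow₀ (one_le_truncLog _))

lemma logWeight_mono : Monotone logWeight := fun x y h => by
  have h1 := truncLog_mono h
  exact mul_le_mul h1 (pow_le_pow_left₀ (by linarith [one_le_truncLog (truncLog x)])
    (truncLog_mono h1) 2) (sq_nonneg _) (by linarith [one_le_truncLog y])

/-- By Cauchy condensation: at `r ^ 2 ^ n` the logarithm is at least `2 ^ n * δ` and its logarithm
is eventually at least `n * (log 2 / 2)`, so the condensed terms are `O(1 / n ^ 2)`. -/
lemma summable_inv_logWeight_pow {r : ℝ} (hr : 1 < r) :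
    Summable fun m : ℕ => (logWeight (r ^ m))⁻¹ := by
  have hpos : ∀ x, 0 < logWeight x := fun x => zero_lt_one.trans_le (one_le_logWeight x)
  have hr0 : 0 < r := by linarith
  set δ := Real.log r with hδ
  have hδ0 : 0 < δ := Real.log_pos hr
  have hlog2 : 0 < Real.log 2 := Real.log_pos (by norm_num)
  rw [← summable_condensed_iff_of_nonneg (fun n => (inv_pos.2 (hpos _)).le)
    (fun m n _ hmn => inv_anti₀ (hpos _) (logWeight_mono (pow_le_pow_right₀ hr.le hmn)))]
  have hbig : ∀ᶠ k : ℕ in atTop, -Real.log δ ≤ k * (Real.log 2 / 2) :=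
    (tendsto_natCast_atTop_atTop.atTop_mul_const (by positivity)).eventually_ge_atTop _
  obtain ⟨K, hK⟩ := eventually_atTop.1 hbig
  have hs : Summable fun k : ℕ => (δ * (Real.log 2 / 2) ^ 2)⁻¹ * (1 / (k : ℝ) ^ 2) :=
    (Real.summable_one_div_nat_pow.2 (by norm_num)).mul_left _
  rw [← summable_nat_add_iff (K + 1)] at hs ⊢
  refine Summable.of_nonneg_of_le (fun k => mul_nonneg (by positivity)
    (inv_pos.2 (hpos _)).le) (fun k => ?_) hs
  generalize hn : k + (K + 1) = n
  have hn0 : (0 : ℝ) < n := by exact_mod_cast (by omega : 0 < n)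
  have h1 : 2 ^ n * δ ≤ truncLog (r ^ 2 ^ n) := by
    have := log_le_truncLog (pow_pos hr0 (2 ^ n))
    rw [Real.log_pow] at this
    exact_mod_cast this
  have h2 : n * (Real.log 2 / 2) ≤ truncLog (truncLog (r ^ 2 ^ n)) := by
    refine le_trans ?_ (truncLog_mono h1)
    refine le_trans ?_ (log_le_truncLog (by positivity))
    rw [Real.log_mul (by positivity) hδ0.ne', Real.log_pow]
    linarith [hK n (by omega)]
  have h3 : 2 ^ n * δ * (n * (Real.log 2 / 2)) ^ 2 ≤ logWeight (r ^ 2 ^ n) :=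
    mul_le_mul h1 (pow_le_pow_left₀ (by positivity) h2 2) (sq_nonneg _)
      (by linarith [one_le_truncLog (r ^ 2 ^ n)])
  calc 2 ^ n * (logWeight (r ^ 2 ^ n))⁻¹
      ≤ 2 ^ n * (2 ^ n * δ * (n * (Real.log 2 / 2)) ^ 2)⁻¹ := by
        gcongr
    _ = (δ * (Real.log 2 / 2) ^ 2)⁻¹ * (1 / (n : ℝ) ^ 2) := by
        field_simp

end Log

/-! ### Choice of the truncation levels. -/

/-- Truncation levels adapted to `L`: geometric growth, a lower bound for the moment weight beyond
each level, and comparison with the normalization given by the de Bruijn conjugate. -/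
lemma exists_truncation_levels {p α : ℝ} (hp1 : 1 ≤ p) (hp2 : p < 2) (hα : 1 / p ≤ α)
    {L Lt : ℝ → ℝ} (hL : IsSlowlyVarying L) (hreg : IsNormalized L)
    (hLt : IsDeBruijnConjugate L Lt) (hLmono : p = 1 → MonotoneOn L (Set.Ici 0)) :
    ∃ (c : ℕ → ℝ) (r : ℝ), 1 < r ∧ (2 : ℝ) ^ (α * p) < r ^ 2 ∧ (∀ m, 0 < c m) ∧
      (∀ m, r * c m ≤ c (m + 1)) ∧ (∀ m, c (m + 1) ≤ 2 ^ (α * p) * c m) ∧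
      (∀ m x, c m < x → ((2 : ℝ) ^ (α * p)) ^ m * logWeight (r ^ m) ≤
        x ^ p * L x ^ p * logWeight x) ∧
      ∃ (κ : ℝ) (N : ℕ), 0 < κ ∧ ∀ k, N ≤ k → ∀ n : ℕ, 2 ^ k ≤ n →
        κ * c (k + 1) ≤ (n : ℝ) ^ α * Lt ((n : ℝ) ^ α) := by
  have hp0 : 0 < p := by linarith
  have hα0 : 0 < α := lt_of_lt_of_le (by positivity) hα
  have hαp : 1 ≤ α * p := by rwa [div_le_iff₀ hp0] at hα
  set Q : ℝ := 2 ^ α with hQ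
  set q : ℝ := 2 ^ (α * p) with hq
  have hqQ : q = Q ^ p := by rw [hq, hQ, ← Real.rpow_mul (by norm_num)]
  have hQ1 : 1 < Q := Real.one_lt_rpow (by norm_num) hα0
  have hQ0 : 0 < Q := by linarith
  have hq2 : 2 ≤ q := by
    simpa using Real.rpow_le_rpow_of_exponent_le (show (1 : ℝ) ≤ 2 by norm_num) hαp
  have hq0 : 0 < q := by linarith
  have hqQ2 : q < Q ^ 2 := by
    rw [hqQ, ← Real.rpow_natCast]
    exact Real.rpow_lt_rpow_of_exponent_lt hQ1 (by exact_mod_cast hp2)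
  -- `r < Q` gives the lower growth of the levels by slow variation, and `r > √q` gives `q < r ^ 2`.
  obtain ⟨r, hr1, hrQ⟩ := exists_between ((Real.sqrt_lt' hQ0).2 hqQ2)
  have hqr : q < r ^ 2 := Real.lt_sq_of_sqrt_lt hr1
  have hr : 1 < r := (Real.one_le_sqrt.2 (by linarith)).trans_lt hr1
  have hr0 : 0 < r := by linarith
  obtain ⟨x₀, γ, hx₀, hpos, hmono, hγ, hγtop⟩ := hreg.exists_inverse hL
  have hgpos : ∀ x, x₀ ≤ x → 0 < x * L x := fun x hx => mul_pos (hx₀.trans_le hx) (hpos x hx)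
  have hlow : ∀ᶠ x in atTop, r * x * L (r * x) < Q * (x * L x) := by
    filter_upwards [(hL.tendsto_mul_ratio hr0).eventually (gt_mem_nhds hrQ),
      eventually_ge_atTop x₀] with x hx hx0
    rwa [div_lt_iff₀ (hgpos x hx0)] at hx
  -- For `p > 1` there is room, as `Q < q`. For `p = 1` the two coincide and the asymptotic ratio
  -- decides nothing; monotonicity of `L` replaces it.
  have hupp : ∀ᶠ x in atTop, Q * (x * L x) ≤ q * x * L (q * x) := by
    rcases hp1.eq_or_lt with h | h
    · have hqeq : q = Q := by rw [hqQ, ← h, Real.rpow_one]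
      filter_upwards [eventually_ge_atTop 0] with x hx
      rw [hqeq, ← mul_assoc]
      refine mul_le_mul_of_nonneg_left (hLmono h.symm hx ?_ ?_) (by positivity)
      · exact Set.mem_Ici.2 (by positivity)
      · exact le_mul_of_one_le_left hx hQ1.le
    · have hQq : Q < q := by
        rw [hqQ]
        simpa using Real.rpow_lt_rpow_of_exponent_lt hQ1 h
      filter_upwards [(hL.tendsto_mul_ratio hq0).eventually (lt_mem_nhds hQq),
        eventually_ge_atTop x₀] with x hx hx0
      rw [lt_div_iff₀ (hgpos x hx0)] at hx
      exact hx.le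
  have hQtop : Tendsto (fun m : ℕ => Q ^ m) atTop atTop := tendsto_pow_atTop_atTop_of_one_lt hQ1
  -- Past `m₀` both growth bounds hold at `γ (Q ^ m)`, `Q ^ m` lies where `γ` is the inverse, and `γ
  -- (Q ^ m) ≥ 1`, whence `c m ≥ r ^ m`.
  obtain ⟨m₀, hm₀⟩ := eventually_atTop.1 (((hγtop.comp hQtop).eventually
    (hlow.and (hupp.and (eventually_ge_atTop 1)))).and (hQtop.eventually_ge_atTop (x₀ * L x₀)))
  simp only [Function.comp] at hm₀
  have hγQ : ∀ m, m₀ ≤ m → x₀ ≤ γ (Q ^ m) ∧ γ (Q ^ m) * L (γ (Q ^ m)) = Q ^ m := fun m hm =>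
    hγ _ (hm₀ m hm).2
  have hc : ∀ m, 0 < γ (Q ^ (m + m₀)) := fun m => hx₀.trans_le (hγQ _ (by omega)).1
  have hcr : ∀ m, r * γ (Q ^ (m + m₀)) ≤ γ (Q ^ (m + 1 + m₀)) := by
    intro m
    obtain ⟨h1, h2⟩ := hγQ (m + m₀) (by omega)
    obtain ⟨h3, h4⟩ := hγQ (m + 1 + m₀) (by omega)
    have h5 := (hm₀ (m + m₀) (by omega)).1.1
    have h6 : x₀ ≤ r * γ (Q ^ (m + m₀)) := h1.trans (le_mul_of_one_le_left (hc m).le hr.le)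
    refine (hmono.le_iff_le h6 h3).1 ?_
    rw [h4]
    rw [h2] at h5
    exact h5.le.trans_eq (by ring)
  have hcq : ∀ m, γ (Q ^ (m + 1 + m₀)) ≤ q * γ (Q ^ (m + m₀)) := by
    intro m
    obtain ⟨h1, h2⟩ := hγQ (m + m₀) (by omega)
    obtain ⟨h3, h4⟩ := hγQ (m + 1 + m₀) (by omega)
    have h5 := (hm₀ (m + m₀) (by omega)).1.2.1
    have h6 : x₀ ≤ q * γ (Q ^ (m + m₀)) :=
      h1.trans (le_mul_of_one_le_left (hc m).le (by linarith))
    refine (hmono.le_iff_le h3 h6).1 ?_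
    rw [h4]
    rw [h2] at h5
    exact le_trans (by rw [← pow_succ']; ring_nf; rfl) h5
  refine ⟨fun m => γ (Q ^ (m + m₀)), r, hr, hqr, hc, hcr, hcq, ?_, ?_⟩
  · intro m x hx
    obtain ⟨h1, h2⟩ := hγQ (m + m₀) (by omega)
    have hx0 : x₀ ≤ x := h1.trans hx.le
    have h3 : Q ^ (m + m₀) ≤ x * L x := by
      rw [← h2]; exact hmono.monotoneOn h1 hx0 hx.le
    have h4 : r ^ m ≤ x := by
      have h5 := geometric_growth_lower (c := fun m => γ (Q ^ (m + m₀))) hr0.le hcr 0 m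
      simp only [zero_add] at h5
      have h6 := (hm₀ m₀ le_rfl).1.2.2
      have h7 : r ^ m * 1 ≤ r ^ m * γ (Q ^ m₀) := mul_le_mul_of_nonneg_left h6 (by positivity)
      linarith
    have h8 : q ^ m ≤ x ^ p * L x ^ p := by
      rw [← Real.mul_rpow (hx₀.trans_le hx0).le (hpos x hx0).le]
      calc q ^ m = (Q ^ m) ^ p := by
            rw [hqQ, Real.rpow_pow_comm hQ0.le]
        _ ≤ (x * L x) ^ p := by
            refine Real.rpow_le_rpow (by positivity) (le_trans ?_ h3) hp0.le
            exact pow_le_pow_right₀ hQ1.le (by omega)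
    exact mul_le_mul h8 (logWeight_mono h4) (zero_le_one.trans (one_le_logWeight _))
      (le_trans (by positivity) h8)
  · obtain ⟨y₁, hy₁⟩ := eventually_atTop.1
      (hLt.eventually_inverse_le (fun y hy => (hγ y hy).2) hγtop)
    obtain ⟨N, hN⟩ := eventually_atTop.1 (hQtop.eventually_ge_atTop y₁)
    -- The `2` comes from the comparison with the conjugate; `q ^ (m₀ + 1)` undoes the shift by `m₀`
    -- and the passage from `k` to `k + 1`.
    refine ⟨1 / (2 * q ^ (m₀ + 1)), max N m₀, by positivity, fun k hk n hn => ?_⟩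
    have hkm : m₀ ≤ k := (le_max_right _ _).trans hk
    have hy : Q ^ k ≤ (n : ℝ) ^ α := by
      rw [hQ, Real.rpow_pow_comm (by norm_num)]
      exact Real.rpow_le_rpow (by positivity) (by exact_mod_cast hn) hα0.le
    obtain ⟨h1, h2⟩ := hγQ k hkm
    obtain ⟨h3, h4⟩ := hγ ((n : ℝ) ^ α) ((hm₀ k hkm).2.trans hy)
    have h5 : γ (Q ^ k) ≤ γ ((n : ℝ) ^ α) := by
      refine (hmono.le_iff_le h1 h3).1 ?_
      rw [h2, h4]; exact hy
    have h6 := hy₁ ((n : ℝ) ^ α) ((hN k ((le_max_left _ _).trans hk)).trans hy)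
    have h7 := geometric_growth_upper (c := fun m => γ (Q ^ (m + m₀))) hq0.le hcq (k - m₀) (m₀ + 1)
    simp only [show k - m₀ + (m₀ + 1) + m₀ = k + 1 + m₀ by omega, Nat.sub_add_cancel hkm] at h7
    calc 1 / (2 * q ^ (m₀ + 1)) * γ (Q ^ (k + 1 + m₀))
        ≤ 1 / (2 * q ^ (m₀ + 1)) * (q ^ (m₀ + 1) * γ (Q ^ k)) := by gcongr
      _ = γ (Q ^ k) / 2 := by field_simp
      _ ≤ γ ((n : ℝ) ^ α) / 2 := by linarith
      _ ≤ _ := h6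

/-! ### From powers of two to all `n`, and the conclusion. -/

lemma ENNReal.tsum_pnat_lt_top_of_dyadic_bound {f : ℕ → ENNReal} {w : ℕ → ℝ} (hw0 : ∀ k, 0 ≤ w k)
    (hw : Summable fun k => 2 ^ k * w k)
    (hf : ∀ k n, 2 ^ k ≤ n → n < 2 ^ (k + 1) → f n ≤ ENNReal.ofReal (w k)) :
    ∑' n : ℕ+, f n < ⊤ := by
  have hterm0 : ∀ k, 0 ≤ 2 ^ k * w k := fun k => mul_nonneg (by positivity) (hw0 k)
  have hdyadic : ∀ N : ℕ, ∑ n ∈ Finset.Ico 1 (2 ^ N), f n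
      ≤ ∑ k ∈ Finset.range N, ENNReal.ofReal (2 ^ k * w k) := by
    intro N
    induction N with
    | zero => simp
    | succ N ih =>
      rw [← Finset.sum_Ico_consecutive f (Nat.one_le_two_pow (n := N))
        (Nat.pow_le_pow_right (by norm_num) (Nat.le_succ N)), Finset.sum_range_succ]
      refine add_le_add ih ((Finset.sum_le_card_nsmul _ _ (ENNReal.ofReal (w N)) fun n hn =>
        hf N n (Finset.mem_Ico.1 hn).1 (Finset.mem_Ico.1 hn).2).trans ?_)
      rw [Nat.card_Ico, nsmul_eq_mul, ENNReal.ofReal_mul (by positivity),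
        show 2 ^ (N + 1) - 2 ^ N = 2 ^ N by rw [pow_succ]; omega]
      refine mul_le_mul_left ?_ _
      rw [ENNReal.ofReal_pow (by norm_num)]
      simp
  rw [tsum_pnat_eq_tsum_succ (f := f)]
  refine (ENNReal.tsum_le_of_sum_range_le (c := ENNReal.ofReal (∑' k, 2 ^ k * w k))
    fun N => ?_).trans_lt ENNReal.ofReal_lt_top
  calc ∑ n ∈ Finset.range N, f (n + 1) = ∑ n ∈ Finset.Ico 1 (N + 1), f n := by
        rw [Finset.sum_Ico_eq_sum_range]
        simp [add_comm]
    _ ≤ ∑ n ∈ Finset.Ico 1 (2 ^ N), f n :=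
        Finset.sum_le_sum_of_subset (Finset.Ico_subset_Ico_right (Nat.lt_two_pow_self))
    _ ≤ ∑ k ∈ Finset.range N, ENNReal.ofReal (2 ^ k * w k) := hdyadic N
    _ = ENNReal.ofReal (∑ k ∈ Finset.range N, 2 ^ k * w k) :=
        (ENNReal.ofReal_sum_of_nonneg fun k _ => hterm0 k).symm
    _ ≤ _ := ENNReal.ofReal_le_ofReal (hw.sum_le_tsum _ fun k _ => hterm0 k)

lemma measureReal_le_of_lintegral_le {Ω : Type*} [MeasurableSpace Ω] {μ : Measure Ω}
    {s : Set Ω} (hs : MeasurableSet s) {F : Ω → ENNReal} {h M : ℝ} (hh : 0 < h) (hM : 0 ≤ M)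
    (hF : ∫⁻ ω, F ω ∂μ ≤ ENNReal.ofReal M) (hle : ∀ ω ∈ s, ENNReal.ofReal h ≤ F ω) :
    μ.real s ≤ M / h := by
  have h1 : ENNReal.ofReal h * μ s ≤ ENNReal.ofReal M := by
    rw [← lintegral_indicator_const hs]
    exact (lintegral_mono fun ω => Set.indicator_le' hle (fun _ _ => bot_le) ω).trans hF
  refine ENNReal.toReal_le_of_le_ofReal (by positivity) ?_
  rw [ENNReal.ofReal_div_of_pos hh]
  rw [ENNReal.le_div_iff_mul_le (Or.inl (by simpa using hh)) (Or.inl ENNReal.ofReal_ne_top),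
    mul_comm]
  exact h1

lemma rpow_le_mul_dyadic_rpow {n k : ℕ} (h1 : 2 ^ k ≤ n) (h2 : n < 2 ^ (k + 1)) (β : ℝ) :
    (n : ℝ) ^ β ≤ max 1 (2 ^ β) * (2 ^ β) ^ k := by
  have hn1 : (2 : ℝ) ^ k ≤ n := by exact_mod_cast h1
  have hn2 : (n : ℝ) ≤ 2 ^ (k + 1) := by exact_mod_cast h2.le
  have hk : ∀ j : ℕ, ((2 : ℝ) ^ j) ^ β = (2 ^ β) ^ j := fun j =>
    (Real.rpow_pow_comm (by norm_num) β j).symm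
  have h0 : (0 : ℝ) < 2 ^ k := by positivity
  rcases le_total 0 β with hβ | hβ
  · calc (n : ℝ) ^ β ≤ (2 ^ (k + 1)) ^ β := Real.rpow_le_rpow (by positivity) hn2 hβ
      _ = 2 ^ β * (2 ^ β) ^ k := by rw [hk, pow_succ']
      _ ≤ _ := by gcongr; exact le_max_right _ _
  · calc (n : ℝ) ^ β ≤ (2 ^ k) ^ β := Real.rpow_le_rpow_of_nonpos h0 hn1 hβ
      _ = 1 * (2 ^ β) ^ k := by rw [hk, one_mul]
      _ ≤ _ := by gcongr; exact le_max_left _ _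

theorem mainTheorem2 {Ω : Type*} [MeasurableSpace Ω] (μ : Measure Ω) [IsProbabilityMeasure μ]
    (p : ℝ) (hp1 : 1 ≤ p) (hp2 : p < 2)
    (X : ℕ → Ω → ℝ) (hX : ∀ n, 1 ≤ n → Measurable (X n))
    (hvar : ∃ C : ℝ, VarianceInequality μ X C)
    (L Lt : ℝ → ℝ) (hL : IsSlowlyVarying L) (hLreg : IsNormalized L)
    (hLt : IsDeBruijnConjugate L Lt)
    (hLone : p = 1 → (∀ x, 0 ≤ x → 1 ≤ L x) ∧ MonotoneOn L (Set.Ici 0))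
    (hmoment : (⨆ n ∈ Set.Ici (1 : ℕ), ∫⁻ ω, ENNReal.ofReal
        (|X n ω| ^ p * L |X n ω| ^ p * truncLog |X n ω| *
          truncLog (truncLog |X n ω|) ^ 2) ∂μ) < ⊤) :
    (∀ n, 1 ≤ n → Integrable (X n) μ) ∧
    ∀ α : ℝ, 1 / p ≤ α → ∀ ε : ℝ, 0 < ε →
      (∑' n : ℕ+, ENNReal.ofReal ((n : ℝ) ^ (α * p - 2)) *
        μ {ω | maxAbsCenteredSum μ X n ω > ε * (n : ℝ) ^ α * Lt ((n : ℝ) ^ α)}) < ⊤ := by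
  have hp0 : 0 < p := by linarith
  obtain ⟨C₀, hC₀⟩ := hvar
  have hC : 0 ≤ max C₀ 0 := le_max_right _ _
  -- The given constant may be negative; enlarging it is harmless because variances are nonnegative.
  have hvar : VarianceInequality μ X (max C₀ 0) := fun k l hl f hf hf2 =>
    (hC₀ k l hl f hf hf2).trans (mul_le_mul_of_nonneg_right (le_max_left _ _)
      (Finset.sum_nonneg fun i _ => variance_nonneg _ _))
  obtain ⟨M, hM, hmom⟩ : ∃ M : ℝ, 0 ≤ M ∧ ∀ i, 1 ≤ i → ∫⁻ ω, ENNReal.ofReal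
      (|X i ω| ^ p * L |X i ω| ^ p * truncLog |X i ω| * truncLog (truncLog |X i ω|) ^ 2) ∂μ
        ≤ ENNReal.ofReal M := by
    refine ⟨ENNReal.toReal (⨆ n ∈ Set.Ici (1 : ℕ), ∫⁻ ω, ENNReal.ofReal
      (|X n ω| ^ p * L |X n ω| ^ p * truncLog |X n ω| * truncLog (truncLog |X n ω|) ^ 2) ∂μ),
      ENNReal.toReal_nonneg, fun i hi => ?_⟩
    rw [ENNReal.ofReal_toReal hmoment.ne]
    exact le_iSup₂ (f := fun n (_ : n ∈ Set.Ici (1 : ℕ)) => ∫⁻ ω, ENNReal.ofReal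
      (|X n ω| ^ p * L |X n ω| ^ p * truncLog |X n ω| * truncLog (truncLog |X n ω|) ^ 2) ∂μ)
      i (Set.mem_Ici.2 hi)
  have hlevels : ∀ α : ℝ, 1 / p ≤ α → ∃ (c a : ℕ → ℝ) (r : ℝ), 1 < r ∧
      (2 : ℝ) ^ (α * p) < r ^ 2 ∧ (∀ m, 0 < c m) ∧
      (∀ m, r * c m ≤ c (m + 1)) ∧ (∀ m, c (m + 1) ≤ 2 ^ (α * p) * c m) ∧
      (∀ m, 0 ≤ a m) ∧ Summable a ∧
      (∀ i, 1 ≤ i → ∀ m, μ.real {ω | c m < |X i ω|} ≤ a m / (2 ^ (α * p)) ^ m) ∧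
      ∃ (κ : ℝ) (N : ℕ), 0 < κ ∧ ∀ k, N ≤ k → ∀ n : ℕ, 2 ^ k ≤ n →
        κ * c (k + 1) ≤ (n : ℝ) ^ α * Lt ((n : ℝ) ^ α) := by
    intro α hα
    obtain ⟨c, r, hr, hqr, hc, hcr, hcq, hw, hκ⟩ :=
      exists_truncation_levels hp1 hp2 hα hL hLreg hLt (fun h => (hLone h).2)
    have hpos : ∀ x, 0 < logWeight x := fun x => zero_lt_one.trans_le (one_le_logWeight x)
    refine ⟨c, fun m => M * (logWeight (r ^ m))⁻¹, r, hr, hqr, hc, hcr, hcq,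
      fun m => mul_nonneg hM (inv_pos.2 (hpos _)).le,
      (summable_inv_logWeight_pow hr).mul_left M, fun i hi m => ?_, hκ⟩
    have hh : 0 < ((2 : ℝ) ^ (α * p)) ^ m * logWeight (r ^ m) := mul_pos (by positivity) (hpos _)
    refine (measureReal_le_of_lintegral_le (measurableSet_lt measurable_const (hX i hi).abs) hh hM
      (hmom i hi) fun ω hω => ENNReal.ofReal_le_ofReal ?_).trans_eq ?_
    · refine (hw m _ hω).trans_eq ?_
      rw [logWeight]; ring
    · rw [mul_comm, div_mul_eq_div_div, div_eq_mul_inv]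
      have := (hpos (r ^ m)).ne'
      field_simp
  have hq2 : ∀ α : ℝ, 1 / p ≤ α → (2 : ℝ) ≤ 2 ^ (α * p) := fun α hα => by
    rw [div_le_iff₀ hp0] at hα
    simpa using Real.rpow_le_rpow_of_exponent_le (show (1 : ℝ) ≤ 2 by norm_num) hα
  refine ⟨fun i hi => ?_, fun α hα ε hε => ?_⟩
  · obtain ⟨c, a, r, hr, hqr, hc, hcr, hcq, ha0, ha, ht, -⟩ := hlevels (1 / p) le_rfl
    have hctop : Tendsto c atTop atTop := by
      refine tendsto_atTop_mono (fun n => ?_)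
        ((tendsto_pow_atTop_atTop_of_one_lt hr).atTop_mul_const (hc 0))
      simpa using geometric_growth_lower (by linarith) hcr 0 n
    exact integrable_of_tail (hX i hi) hc hctop (ht i hi)
      (summable_mul_div_pow (by positivity) hc hcq ha0 ha)
  obtain ⟨c, a, r, hr, hqr, hc, hcr, hcq, ha0, ha, ht, κ, N, hκ, hN⟩ := hlevels α hα
  have hq0 : (0 : ℝ) < 2 ^ (α * p) := by positivity
  have hsum := summable_measureReal_dyadic_max hX hC hvar (hq2 α hα) hr hqr hc hcr hcq ha0 ha ht
    (show 0 < ε * κ by positivity)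
  set E : ℕ → Set Ω := fun n => {ω | ∃ j ≤ 2 ^ n,
    ε * κ * c n < |∑ i ∈ Finset.Icc 1 j, (X i ω - ∫ ω', X i ω' ∂μ)|} with hE
  set K : ℝ := max 1 (2 ^ (α * p - 2)) with hK
  have hK0 : 0 < K := lt_max_of_lt_left one_pos
  -- For `2 ^ k ≤ n < 2 ^ (k + 1)` the maximum is compared with scale `k + 1`. The finitely many `k
  -- < N`, where the normalization is not controlled, get the trivial bound `1`.
  set d : ℕ → ℝ := fun k => if N ≤ k then μ.real (E (k + 1)) else 1 with hd
  have hd0 : ∀ k, 0 ≤ d k := fun k => by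
    simp only [hd]; split_ifs
    · exact measureReal_nonneg
    · exact zero_le_one
  refine ENNReal.tsum_pnat_lt_top_of_dyadic_bound (f := fun n : ℕ =>
    ENNReal.ofReal ((n : ℝ) ^ (α * p - 2)) * μ {ω | if h : 0 < n then
      maxAbsCenteredSum μ X ⟨n, h⟩ ω > ε * (n : ℝ) ^ α * Lt ((n : ℝ) ^ α) else False})
    (w := fun k => K * (2 ^ (α * p - 2)) ^ k * d k) ?_ ?_ ?_ |>.trans_eq' ?_
  · exact fun k => mul_nonneg (by positivity) (hd0 k)
  · rw [← summable_nat_add_iff (N + 1)] at hsum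
    rw [← summable_nat_add_iff N]
    -- Here `2 ^ k * (2 ^ (α * p - 2)) ^ k = (q / 2) ^ k` with `q = 2 ^ (α * p)`, and the shift to
    -- scale `k + 1` costs the factor `2 / q`.
    refine (hsum.mul_left (K * (2 / 2 ^ (α * p)))).congr fun k => ?_
    have h1 : d (k + N) = μ.real (E (k + N + 1)) := if_pos (Nat.le_add_left _ _)
    have h2 : (2 : ℝ) ^ (α * p - 2) = 2 ^ (α * p) / 4 := by
      rw [Real.rpow_sub (by norm_num)]; norm_num
    rw [h1, h2, ← add_assoc]
    have h3 : (2 : ℝ) ^ (k + N) * (2 ^ (α * p) / 4) ^ (k + N) = (2 ^ (α * p) / 2) ^ (k + N) := by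
      rw [← mul_pow]; congr 1; ring
    calc _ = K * (2 / 2 ^ (α * p) * (2 ^ (α * p) / 2)) * (2 ^ (α * p) / 2) ^ (k + N)
          * μ.real (E (k + N + 1)) := by rw [pow_succ]; ring
      _ = K * (2 ^ (α * p) / 2) ^ (k + N) * μ.real (E (k + N + 1)) := by
          rw [div_mul_div_cancel₀ hq0.ne', div_self (by norm_num), mul_one]
      _ = _ := by rw [← h3]; ring
  · intro k n h1 h2
    have hn : 0 < n := lt_of_lt_of_le (by positivity) h1
    rw [ENNReal.ofReal_mul (by positivity)]
    refine mul_le_mul' (ENNReal.ofReal_le_ofReal (rpow_le_mul_dyadic_rpow h1 h2 _)) ?_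
    by_cases hk : N ≤ k
    · rw [show d k = μ.real (E (k + 1)) from if_pos hk, ofReal_measureReal]
      refine measure_mono fun ω hω => ?_
      simp only [Set.mem_ofPred_eq, dif_pos hn, maxAbsCenteredSum, gt_iff_lt,
        Finset.lt_sup'_iff, PNat.mk_coe] at hω
      obtain ⟨j, hj, hlt⟩ := hω
      refine ⟨j, (Finset.mem_Icc.1 hj).2.trans h2.le, lt_of_le_of_lt ?_ hlt⟩
      rw [mul_assoc, mul_assoc]
      exact mul_le_mul_of_nonneg_left (hN k hk n h1) hε.le
    · simp only [hd, if_neg hk, ENNReal.ofReal_one]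
      exact prob_le_one
  · refine tsum_congr fun n => ?_
    simp only [dif_pos n.pos]
    rfl
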